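/- **Setting.** Let $(\Omega,\mathcal F,\mathbf P)$ be a probability space with a measurable, $\mathbf P$-preserving semiflow $(\theta^t)_{t\ge0}$, and let $(Z,\mathrm{dist})$ be a complete separable metric space with its Borel $\sigma$-algebra. For metric spaces $V,W$ let $C_{u,b}(V,W)$ be the space of continuous maps $V\to W$ that are uniformly continuous with bounded image on every bounded subset of $V$, with the topology of uniform convergence on bounded sets. Let $\mathcal T$ be a continuous random dynamical system on $Z$: for each $\omega$, $\mathcal T_\omega\in C_{u,b}([0,\infty)\times Z,Z)$, $(t,\omega,z)\mapsto\mathcal T^t_\omega z$ is measurable, $\mathcal T^0_\omega=\mathrm{Id}$ and $\mathcal T^{s+t}_\omega=\mathcal T^t_{\theta^s\omega}\circ\mathcal T^s_\omega$. Assume that for all $s,t>0$ the $C_{u,b}(Z,Z)$-valued random variables $\mathcal T^t_\omega$ and $\mathcal T^s_{\theta^t\omega}$ are independent. Put $P_t(z,K)=\mathbf P(\mathcal T^t_\omega z\in K)$ and $P_th(z)=\int h(z')\,P_t(z,dz')$. Assume the strong Feller property: $P_th$ is bounded and continuous for every bounded measurable $h:Z\to\mathbb R$ and every $t>0$. Let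 $\mu$ be an ergodic stationary Borel probability measure: $\int P_t(z,\cdot)\,d\mu(z)=\mu$ for all $t\ge0$, and every bounded measurable $h$ such that, for each $t\ge0$, $P_th=h$ $\mu$-a.s., is $\mu$-a.s. constant. Let $1\le d\le3$ and let $\mathcal A$ be an $SL_d(\mathbb R)$ linear cocycle over $\mathcal T$: for each $\omega$, $\mathcal A_\omega\in C_{u,b}([0,\infty)\times Z,M_{d\times d}(\mathbb R))$, $(\omega,t,z)\mapsto\mathcal A^t_{\omega,z}$ is measurable, $\det\mathcal A^t_{\omega,z}=1$, $\mathcal A^0_{\omega,z}=\mathrm{Id}$ and $\mathcal A^{s+t}_{\omega,z}=\mathcal A^s_{\theta^t\omega,\mathcal T^t_\omega z}\mathcal A^t_{\omega,z}$. Assume that $$\mathbf E\int\sup_{0\le t\le1}\log^+|\mathcal A^t_{\omega,z}|\,d\mu(z)<\infty,\qquad \mathbf E\int\sup_{0\le t\le1}\log^+|(\mathcal A^t_{\omega,z})^{-1}|\,d\mu(z)<\infty,$$ and that for all $s,t>0$ the random variables $(\mathcal T^t_\omega,\mathcal A^t_\omega)$ and $(\mathcal T^s_{\theta^t\omega},\mathcal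 A^s_{\theta^t\omega})$, with values in $\mathcal C=C_{u,b}(Z,Z)\times C_{u,b}(Z,M_{d\times d}(\mathbb R))$, are independent. Let $\mathcal S_t\subset\mathcal C$ be the topological support of the random variable $(\mathcal T^t_\omega,\mathcal A^t_\omega)$, and let $\mathcal S=\overline{\bigcup_{t\ge0}\mathcal S_t}$. Let $(\bar\nu_z)_{z\in\operatorname{supp}\mu}$ be a family of Borel probability measures on the projective space $P^{d-1}=P(\mathbb R^d)$ that is weak$^*$ continuous in $z\in\operatorname{supp}\mu$ and invariant: for each $t\ge0$, $(\mathcal A^t_{\omega,z})_*\bar\nu_z=\bar\nu_{\mathcal T^t_\omega z}$ for $\mathbf P\times\mu$-almost every $(\omega,z)$. **Theorem (classification of invariant fiber measure families).** For all $(T,A)\in\mathcal S$ and $z\in\operatorname{supp}\mu$ we have $Tz\in\operatorname{supp}\mu$, and (at least) one of the following alternatives holds. (a) There is a continuously varying assignment to each $z\in\operatorname{supp}\mu$ of an inner product $\langle\cdot,\cdot\rangle_z$ on $\mathbb R^d$ such that for all $(T,A)\in\mathcal S$ and $z\in\operatorname{supp}\mu$, the map $A_z:(\mathbb R^d,\langle\cdot,\cdot\rangle_z)\to(\mathbb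 R^d,\langle\cdot,\cdot\rangle_{Tz})$ is an isometry. (b) For some $p\ge1$ there are $p$ measurably varying assignments to each $z\in\operatorname{supp}\mu$ of proper, nontrivial linear subspaces $E^1_z,\dots,E^p_z\subsetneq\mathbb R^d$, distinct for each $z$, such that: - for all $(T,A)\in\mathcal S$ and $z\in\operatorname{supp}\mu$ there is a permutation $\pi$ of $\{1,\dots,p\}$ (which may depend on $(T,A)$ and on $z$) with $A_zE^i_z=E^{\pi(i)}_{Tz}$ for all $1\le i\le p$; - $\bar\nu_z\big(\bigcup_{i=1}^pE^i_z\big)=1$ for all $z\in\operatorname{supp}\mu$ (each $E^i_z$ being identified with the set of lines in it); - the collection $(E^i_z)$ is locally continuous up to relabeling: every $z\in\operatorname{supp}\mu$ has an open neighborhood $U\subset Z$ on which the $p$ subspaces can be relabeled, separately at each $y\in U\cap\operatorname{supp}\mu$, so that $y\mapsto E^i_y$ is continuous on $U\cap\operatorname{supp}\mu$ for each $1\le i\le p$. -/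

import Mathlib

open MeasureTheory ProbabilityTheory Topology
open scoped NNReal ENNReal

noncomputable section

namespace FiberClass

/-! ### Maps that are uniformly continuous and bounded on bounded sets -/

/-- The space `C_{u,b}(V, W)` of continuous maps `V → W` which, on every bounded subset of `V`, are
uniformly continuous and have bounded image. -/
structure CUB (V W : Type*) [MetricSpace V] [MetricSpace W] where
  toFun : V → W
  continuous_toFun : Continuous toFun
  uniformContinuousOn : ∀ U : Set V, Bornology.IsBounded U → UniformContinuousOn toFun U
  isBounded_image : ∀ U : Set V, Bornology.IsBounded U → Bornology.IsBounded (toFun '' U)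

namespace CUB

variable {V W : Type*} [MetricSpace V] [MetricSpace W]

instance : CoeFun (CUB V W) (fun _ => V → W) := ⟨toFun⟩

/-- The topology of uniform convergence on bounded sets. -/
instance : TopologicalSpace (CUB V W) :=
  TopologicalSpace.induced
    (fun f : CUB V W => UniformOnFun.ofFun {U : Set V | Bornology.IsBounded U} f.toFun)
    inferInstance

instance : MeasurableSpace (CUB V W) := borel _

instance : BorelSpace (CUB V W) := ⟨rfl⟩

/-- The time-`t` slice of an element of `C_{u,b}([0,∞) × V, W)`. -/
def slice (f : CUB (ℝ≥0 × V) W) (t : ℝ≥0) : CUB V W where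
  toFun v := f (t, v)
  continuous_toFun := f.continuous_toFun.comp (by fun_prop)
  uniformContinuousOn U hU := by
    have hb : Bornology.IsBounded (({t} : Set ℝ≥0) ×ˢ U) := Bornology.isBounded_singleton.prod hU
    refine (f.uniformContinuousOn _ hb).comp (g := f.toFun) (f := fun v => (t, v)) ?_ ?_
    · exact (uniformContinuous_const.prodMk uniformContinuous_id).uniformContinuousOn
    · intro v hv
      exact ⟨rfl, hv⟩
  isBounded_image U hU := by
    have hb : Bornology.IsBounded (({t} : Set ℝ≥0) ×ˢ U) := Bornology.isBounded_singleton.prod hU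
    refine (f.isBounded_image _ hb).subset ?_
    rintro _ ⟨v, hv, rfl⟩
    exact ⟨(t, v), ⟨rfl, hv⟩, rfl⟩

end CUB

/-! ### Random dynamical systems and their Markov semigroups -/

/-- A measurable, measure-preserving semiflow `θ` on `(Ω, P)`. -/
structure Semiflow {Ω : Type*} [MeasurableSpace Ω] (P : Measure Ω) where
  toFun : ℝ≥0 → Ω → Ω
  measurable_uncurry : Measurable fun p : ℝ≥0 × Ω => toFun p.1 p.2
  map_zero : ∀ ω, toFun 0 ω = ω
  map_add : ∀ s t ω, toFun (t + s) ω = toFun t (toFun s ω)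
  measurePreserving : ∀ t, MeasurePreserving (toFun t) P P

/-- A continuous random dynamical system on `Z` over the semiflow `θ`;
`toFun ω (t, z)` is the position at time `t` of the point that starts in `z`. -/
structure ContinuousRDS {Ω : Type*} [MeasurableSpace Ω] {P : Measure Ω} (θ : Semiflow P)
    (Z : Type*) [MetricSpace Z] [MeasurableSpace Z] where
  toFun : Ω → CUB (ℝ≥0 × Z) Z
  measurable_eval : Measurable fun p : ℝ≥0 × Ω × Z => toFun p.2.1 (p.1, p.2.2)
  map_zero : ∀ ω z, toFun ω (0, z) = z
  map_add : ∀ ω s t z, toFun ω (s + t, z) = toFun (θ.toFun s ω) (t, toFun ω (s, z))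

namespace ContinuousRDS

variable {Ω : Type*} [MeasurableSpace Ω] {P : Measure Ω} {θ : Semiflow P}
  {Z : Type*} [MetricSpace Z] [MeasurableSpace Z]

/-- The random map `T^t_ω : Z → Z`, an element of `C_{u,b}(Z, Z)`. -/
def timeMap (T : ContinuousRDS θ Z) (t : ℝ≥0) (ω : Ω) : CUB Z Z := (T.toFun ω).slice t

/-- Independent increments of the random dynamical system. -/
def IndepIncrements (T : ContinuousRDS θ Z) : Prop :=
  ∀ s t : ℝ≥0, 0 < s → 0 < t →
    IndepFun (fun ω => T.timeMap t ω) (fun ω => T.timeMap s (θ.toFun t ω)) P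

/-- The transition probability `P_t(z, ·)`, i.e. the law of `T^t_ω z`. -/
def transition (T : ContinuousRDS θ Z) (t : ℝ≥0) (z : Z) : Measure Z :=
  P.map fun ω => T.timeMap t ω z

/-- The Markov semigroup on observables, `(P_t h)(z) = ∫ h(z') P_t(z, dz')`. -/
def semigroup (T : ContinuousRDS θ Z) (t : ℝ≥0) (h : Z → ℝ) (z : Z) : ℝ :=
  ∫ z', h z' ∂(T.transition t z)

/-- The strong Feller property. -/
def StrongFeller (T : ContinuousRDS θ Z) : Prop :=
  ∀ h : Z → ℝ, Measurable h → (∃ C, ∀ z, |h z| ≤ C) → ∀ t : ℝ≥0, 0 < t →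
    Continuous (T.semigroup t h) ∧ ∃ C, ∀ z, |T.semigroup t h z| ≤ C

/-- `μ` is stationary: `(P_t)^* μ = μ` for all `t ≥ 0`. -/
def Stationary (T : ContinuousRDS θ Z) (μ : Measure Z) : Prop :=
  ∀ (t : ℝ≥0) (K : Set Z), MeasurableSet K → ∫⁻ z, T.transition t z K ∂μ = μ K

/-- `μ` is stationary and every bounded measurable `h` with `P_t h = h` `μ`-almost surely
for each `t ≥ 0` is `μ`-almost surely constant. -/
def ErgodicStationary (T : ContinuousRDS θ Z) (μ : Measure Z) : Prop :=
  T.Stationary μ ∧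
    ∀ h : Z → ℝ, Measurable h → (∃ C, ∀ z, |h z| ≤ C) →
      (∀ t : ℝ≥0, T.semigroup t h =ᵐ[μ] h) → ∃ c : ℝ, h =ᵐ[μ] fun _ => c

end ContinuousRDS

/-! ### Linear cocycles -/

/-- `ℝ^d` with its Euclidean structure. -/
abbrev Vec (d : ℕ) : Type := EuclideanSpace ℝ (Fin d)

/-- Real `d × d` matrices, as operators on `ℝ^d` with the operator norm. -/
abbrev Mat (d : ℕ) : Type := Vec d →L[ℝ] Vec d

/-- A `d`-dimensional linear cocycle over `T`; `toFun ω (t, z)` is the matrix `A^t_{ω,z}`. -/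
structure LinearCocycle {Ω : Type*} [MeasurableSpace Ω] {P : Measure Ω} {θ : Semiflow P}
    {Z : Type*} [MetricSpace Z] [MeasurableSpace Z] (T : ContinuousRDS θ Z) (d : ℕ) where
  toFun : Ω → CUB (ℝ≥0 × Z) (Mat d)
  measurable_eval : Measurable fun p : Ω × ℝ≥0 × Z => toFun p.1 p.2
  map_zero : ∀ ω z, toFun ω (0, z) = ContinuousLinearMap.id ℝ (Vec d)
  map_add : ∀ ω s t z,
    toFun ω (s + t, z) = (toFun (θ.toFun t ω) (s, T.toFun ω (t, z))).comp (toFun ω (t, z))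

/-- Real projective space `P^{d-1}`. -/
abbrev Proj (d : ℕ) : Type := Projectivization ℝ (Vec d)

/-- The quotient topology of `ℝ^d \ {0}`. -/
instance (d : ℕ) : TopologicalSpace (Proj d) :=
  TopologicalSpace.coinduced (Projectivization.mk' ℝ : {v : Vec d // v ≠ 0} → Proj d) inferInstance

instance (d : ℕ) : MeasurableSpace (Proj d) := borel _

instance (d : ℕ) : BorelSpace (Proj d) := ⟨rfl⟩

/-- The action of an invertible matrix on projective space. -/
def projMap {d : ℕ} (M : Mat d) (hM : Function.Injective M) : Proj d → Proj d :=
  Projectivization.map (M : Vec d →ₗ[ℝ] Vec d) hM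

theorem injective_of_det_eq_one {d : ℕ} {M : Mat d} (h : M.det = 1) : Function.Injective M := by
  have hu : IsUnit (LinearMap.det (M : Vec d →ₗ[ℝ] Vec d)) := by
    have h' : LinearMap.det (M : Vec d →ₗ[ℝ] Vec d) = 1 := h
    rw [h']
    exact isUnit_one
  have := (LinearMap.isUnit_iff_ker_eq_bot _).1 ((LinearMap.isUnit_iff_isUnit_det _).2 hu)
  exact LinearMap.ker_eq_bot.1 this

namespace LinearCocycle

variable {Ω : Type*} [MeasurableSpace Ω] {P : Measure Ω} {θ : Semiflow P}
  {Z : Type*} [MetricSpace Z] [MeasurableSpace Z] {T : ContinuousRDS θ Z} {d : ℕ}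

/-- The random map `z ↦ A^t_{ω,z}`, an element of `C_{u,b}(Z, M_{d×d}(ℝ))`. -/
def timeMap (A : LinearCocycle T d) (t : ℝ≥0) (ω : Ω) : CUB Z (Mat d) := (A.toFun ω).slice t

/-- `A` is an `SL_d(ℝ)` cocycle. -/
def IsSpecialLinear (A : LinearCocycle T d) : Prop :=
  ∀ (t : ℝ≥0) (ω : Ω) (z : Z), (A.timeMap t ω z).det = 1

/-- The integrability condition on the cocycle and on its inverse
(`Ring.inverse` is the inverse of an invertible operator). -/
def LogIntegrable (A : LinearCocycle T d) (μ : Measure Z) : Prop :=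
  (∫⁻ ω, ∫⁻ z, ⨆ t ∈ Set.Icc (0 : ℝ≥0) 1,
      ENNReal.ofReal (Real.posLog ‖A.timeMap t ω z‖) ∂μ ∂P < ∞) ∧
  (∫⁻ ω, ∫⁻ z, ⨆ t ∈ Set.Icc (0 : ℝ≥0) 1,
      ENNReal.ofReal (Real.posLog ‖Ring.inverse (A.timeMap t ω z)‖) ∂μ ∂P < ∞)

/-- The pair `(T^t_ω, A^t_ω)` in `C_{u,b}(Z, Z) × C_{u,b}(Z, M_{d×d}(ℝ))`. -/
def pair (A : LinearCocycle T d) (t : ℝ≥0) (ω : Ω) : CUB Z Z × CUB Z (Mat d) :=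
  (T.timeMap t ω, A.timeMap t ω)

/-- Independent increments of the pair `(T, A)`. -/
def IndepIncrements (A : LinearCocycle T d) : Prop :=
  ∀ s t : ℝ≥0, 0 < s → 0 < t →
    IndepFun (fun ω => A.pair t ω) (fun ω => A.pair s (θ.toFun t ω)) P

/-- The topological support `S_t` of the random variable `ω ↦ (T^t_ω, A^t_ω)`. -/
def supportAt (A : LinearCocycle T d) (t : ℝ≥0) : Set (CUB Z Z × CUB Z (Mat d)) :=
  {c | ∀ U ∈ 𝓝 c, 0 < P {ω | A.pair t ω ∈ U}}

/-- The closed set `S`, the closure of `⋃_{t ≥ 0} S_t`. -/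
def totalSupport (A : LinearCocycle T d) : Set (CUB Z Z × CUB Z (Mat d)) :=
  closure (⋃ t : ℝ≥0, A.supportAt t)

/-- `(A^t_{ω,z})_* ν_z = ν_{T^t_ω z}` for each `t ≥ 0` and `P × μ`-almost every `(ω, z)`. -/
def InvariantFamily (A : LinearCocycle T d) (hA : A.IsSpecialLinear) (μ : Measure Z)
    (ν : Z → ProbabilityMeasure (Proj d)) : Prop :=
  ∀ t : ℝ≥0, ∀ᵐ p ∂(P.prod μ),
    (ν p.2 : Measure (Proj d)).map
        (projMap (A.timeMap t p.1 p.2) (injective_of_det_eq_one (hA t p.1 p.2))) =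
      (ν (T.timeMap t p.1 p.2) : Measure (Proj d))

end LinearCocycle

/-! ### The two alternatives -/

/-- A bilinear form that is an inner product. -/
def IsInnerProduct {d : ℕ} (b : Vec d →L[ℝ] Vec d →L[ℝ] ℝ) : Prop :=
  (∀ v w, b v w = b w v) ∧ ∀ v, v ≠ 0 → 0 < b v v

variable {Z : Type*} [MetricSpace Z]

/-- On `X`, there is a continuously varying family of inner products for which all
`(T, A) ∈ S` act isometrically. -/
def HasInvariantInnerProducts {d : ℕ} (S : Set (CUB Z Z × CUB Z (Mat d))) (X : Set Z) : Prop :=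
  ∃ g : Z → Vec d →L[ℝ] Vec d →L[ℝ] ℝ,
    ContinuousOn g X ∧
    (∀ z ∈ X, IsInnerProduct (g z)) ∧
    ∀ c ∈ S, ∀ z ∈ X, ∀ v w : Vec d, g (c.1 z) (c.2 z v) (c.2 z w) = g z v w

/-- On `X`, there are finitely many measurable families of distinct, proper, nontrivial subspaces
which are permuted by all `(T, A) ∈ S`, carry the measures `ν`, and are locally
continuous up to relabeling. The Grassmannian carries the topology and
Borel structure induced by identifying a subspace with the orthogonal projection onto it. -/
def HasInvariantSubspaces {d : ℕ} [MeasurableSpace Z] (S : Set (CUB Z Z × CUB Z (Mat d)))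
    (X : Set Z) (ν : Z → ProbabilityMeasure (Proj d)) : Prop :=
  ∃ (p : ℕ) (E : Fin p → Z → Submodule ℝ (Vec d)),
    1 ≤ p ∧
    (∀ i, Measurable fun z : X => (E i z).starProjection) ∧
    (∀ z ∈ X, Function.Injective (fun i => E i z) ∧ ∀ i, E i z ≠ ⊥ ∧ E i z ≠ ⊤) ∧
    (∀ c ∈ S, ∀ z ∈ X, ∃ π : Equiv.Perm (Fin p), ∀ i,
      (E i z).map (c.2 z : Vec d →ₗ[ℝ] Vec d) = E (π i) (c.1 z)) ∧
    (∀ z ∈ X, (ν z : Measure (Proj d)) {x | ∃ i, x.submodule ≤ E i z} = 1) ∧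
    ∀ z ∈ X, ∃ U : Set Z, IsOpen U ∧ z ∈ U ∧ ∃ σ : Z → Equiv.Perm (Fin p), ∀ i,
      ContinuousOn (fun y => (E (σ y i) y).starProjection) (U ∩ X)

end FiberClass

end

namespace FiberClass

open Filter Set

/-! ### Topology of projective space -/

/-! The proof splits on whether some fiber measure is carried by finitely many proper subspaces
(`Degenerate`). Two tools drive both cases.

First, rigidity along the support. The pairs that preserve the fiber measures at every point of the
support form a closed set, so it contains all of `totalSupport` (`totalSupport_subset_preservers`).
If a nonempty closed subset of the support is invariant in both directions under these pairs, its
indicator is fixed by the semigroup; ergodicity makes it constant almost surely, and strong Feller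
makes it constant on the whole support (`eq_support_of_invariant`). Hence a closed property of the
fiber measure that is invariant under `SL d` holds everywhere once it holds somewhere.

Second, Furstenberg's lemma (`exists_subseq_tendsto_of_push`): if the images of one measure under a
sequence in `SL d` converge to a nondegenerate measure, the sequence has a convergent subsequence.

In the degenerate case, choose the dimensions of a carrying family as small as possible in a
well-founded order. Rigidity makes this list of dimensions available and minimal at every point. Two
minimal carrying families agree up to order, since otherwise their intersections would give a
smaller one. Uniqueness gives the permutations, and together with compactness of Grassmannians it
gives local continuity.

In the nondegenerate case, Furstenberg's lemma makes `SL d`-orbits relatively closed and stabilizers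
bounded. By rigidity all fiber measures lie in one orbit. An inner product fixed by the stabilizer
of one of them is transported along the orbit; the result does not depend on the transporting
matrices, hence is continuous and invariant. -/

/-- The orthogonal projection onto a line; this embeds projective space into the operators. -/
noncomputable def lineProj {d : ℕ} (x : Proj d) : Mat d := x.submodule.starProjection

theorem lineProj_mk {d : ℕ} (v : Vec d) (hv : v ≠ 0) :
    lineProj (Projectivization.mk ℝ v hv) = (‖v‖ ^ 2)⁻¹ • (innerSL ℝ v).smulRight v := by
  ext1 w
  have h : (Projectivization.mk ℝ v hv).submodule = Submodule.span ℝ {v} :=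
    Projectivization.submodule_mk v hv
  simp only [lineProj, h]
  rw [Submodule.starProjection_singleton]
  simp [smul_smul, div_eq_inv_mul]

theorem continuous_lineProj {d : ℕ} : Continuous (lineProj : Proj d → Mat d) := by
  refine continuous_coinduced_dom.2 ?_
  have : (lineProj ∘ Projectivization.mk' ℝ : {v : Vec d // v ≠ 0} → Mat d) =
      fun v => (‖v.1‖ ^ 2)⁻¹ • (innerSL ℝ v.1).smulRight v.1 := by
    funext v
    exact lineProj_mk v.1 v.2
  rw [this]
  have h1 : Continuous fun v : {v : Vec d // v ≠ 0} => (‖v.1‖ ^ 2)⁻¹ := by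
    refine Continuous.inv₀ (by fun_prop) fun v => ?_
    have := norm_pos_iff.2 v.2
    positivity
  have h2 : Continuous fun v : {v : Vec d // v ≠ 0} =>
      (ContinuousLinearMap.smulRightL ℝ (Vec d) (Vec d) (innerSL ℝ v.1)) v.1 := by
    fun_prop
  exact h1.smul h2

theorem lineProj_injective {d : ℕ} : Function.Injective (lineProj : Proj d → Mat d) := by
  intro x y h
  exact Projectivization.submodule_injective (Submodule.starProjection_inj.1 h)

theorem norm_lineProj_le {d : ℕ} (x : Proj d) : ‖lineProj x‖ ≤ 1 :=
  Submodule.starProjection_norm_le _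

theorem lineProj_ne_zero {d : ℕ} (x : Proj d) : lineProj x ≠ 0 := by
  intro h
  have h1 : x.rep ∈ x.submodule := by
    rw [Projectivization.submodule_eq]
    exact Submodule.mem_span_singleton_self _
  have h2 := Submodule.starProjection_eq_self_iff.2 h1
  have h3 : x.submodule.starProjection = 0 := h
  rw [h3] at h2
  exact x.rep_nonzero (by simpa using h2.symm)

theorem submodule_le_iff_comp_lineProj {d : ℕ} (x : Proj d) (V : Submodule ℝ (Vec d)) :
    x.submodule ≤ V ↔ V.starProjection.comp (lineProj x) = lineProj x := by
  constructor
  · intro h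
    ext1 w
    exact Submodule.starProjection_eq_self_iff.2 (h (Submodule.starProjection_apply_mem _ _))
  · intro h v hv
    have h1 := Submodule.starProjection_eq_self_iff.2 hv
    have h2 := DFunLike.congr_fun h v
    rw [ContinuousLinearMap.comp_apply, show lineProj x v = v from h1] at h2
    exact Submodule.starProjection_eq_self_iff.1 h2

instance compactSpace_proj (d : ℕ) : CompactSpace (Proj d) := by
  let f : Metric.sphere (0 : Vec d) 1 → {v : Vec d // v ≠ 0} := fun v =>
    ⟨v.1, norm_ne_zero_iff.1 (by rw [mem_sphere_zero_iff_norm.1 v.2]; exact one_ne_zero)⟩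
  have hf : Continuous f := by fun_prop
  have hq : Continuous (Projectivization.mk' ℝ : {v : Vec d // v ≠ 0} → Proj d) :=
    continuous_coinduced_rng
  refine ⟨?_⟩
  have h := isCompact_range (hq.comp hf)
  convert h
  symm
  rw [Set.range_eq_univ]
  intro x
  induction x using Projectivization.ind with
  | h v hv =>
    have hv' : ‖v‖ ≠ 0 := norm_ne_zero_iff.2 hv
    refine ⟨⟨‖v‖⁻¹ • v, by simp [norm_smul, hv']⟩, ?_⟩
    exact (Projectivization.mk_eq_mk_iff' ℝ _ _ _ _).2 ⟨‖v‖⁻¹, rfl⟩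

theorem isClosedEmbedding_lineProj {d : ℕ} : IsClosedEmbedding (lineProj : Proj d → Mat d) :=
  continuous_lineProj.isClosedEmbedding lineProj_injective

instance metrizableSpace_proj (d : ℕ) : TopologicalSpace.MetrizableSpace (Proj d) :=
  isClosedEmbedding_lineProj.isEmbedding.metrizableSpace

instance hasOuterApproxClosed_proj (d : ℕ) : HasOuterApproxClosed (Proj d) := by
  let _ := TopologicalSpace.metrizableSpaceMetric (Proj d)
  infer_instance

/-! ### The action of `SL_d` on measures -/

/-- Operators of determinant one. -/
abbrev SL (d : ℕ) : Type := {g : Mat d // g.det = 1}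

theorem det_comp {d : ℕ} (g h : Mat d) : (g.comp h).det = g.det * h.det :=
  LinearMap.det_comp (g : Vec d →ₗ[ℝ] Vec d) (h : Vec d →ₗ[ℝ] Vec d)

/-- The action of `SL_d` on projective space. -/
noncomputable def act {d : ℕ} (g : SL d) : Proj d → Proj d :=
  projMap g.1 (injective_of_det_eq_one g.2)

theorem submodule_act {d : ℕ} (g : SL d) (x : Proj d) :
    (act g x).submodule = x.submodule.map (g.1 : Vec d →ₗ[ℝ] Vec d) := by
  induction x using Projectivization.ind with
  | h v hv =>
    rw [act, projMap, Projectivization.map_mk, Projectivization.submodule_mk,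
      Projectivization.submodule_mk, Submodule.map_span, Set.image_singleton]

/-- For a line spanned by `v`, both sides are the rank-one operator `w ↦ ⟨gv, w⟩ gv / |gv|²`. The
right side uses no representative vector, so continuity can be read off, and it still makes sense
for singular matrices that do not kill the line. -/
theorem lineProj_act {d : ℕ} (g : SL d) (x : Proj d) :
    lineProj (act g x) = (‖g.1.comp (lineProj x)‖ ^ 2)⁻¹ •
      (g.1.comp ((lineProj x).comp (ContinuousLinearMap.adjoint g.1))) := by
  induction x using Projectivization.ind with
  | h v hv =>
    have hg : g.1 v ≠ 0 := fun h => hv (injective_of_det_eq_one g.2 (by simpa using h))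
    have hv' : ‖v‖ ≠ 0 := norm_ne_zero_iff.2 hv
    have h1 : act g (Projectivization.mk ℝ v hv) = Projectivization.mk ℝ (g.1 v) hg := by
      rw [act, projMap, Projectivization.map_mk]
      rfl
    have h2 : g.1.comp (lineProj (Projectivization.mk ℝ v hv)) =
        (‖v‖ ^ 2)⁻¹ • (innerSL ℝ v).smulRight (g.1 v) := by
      rw [lineProj_mk]
      ext1 w
      simp
    have h3 : ‖g.1.comp (lineProj (Projectivization.mk ℝ v hv))‖ = ‖g.1 v‖ / ‖v‖ := by
      rw [h2, norm_smul, ContinuousLinearMap.norm_smulRight_apply, innerSL_apply_norm]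
      simp
      field_simp
    have hg' : ‖g.1 v‖ ≠ 0 := norm_ne_zero_iff.2 hg
    rw [h1, h3, ← ContinuousLinearMap.comp_assoc, h2, lineProj_mk]
    ext1 w
    simp only [smul_apply, ContinuousLinearMap.comp_apply,
      ContinuousLinearMap.smulRight_apply, innerSL_apply_apply, smul_smul,
      ContinuousLinearMap.adjoint_inner_right]
    congr 1
    field_simp

theorem continuous_act {d : ℕ} : Continuous fun p : SL d × Proj d => act p.1 p.2 := by
  rw [isClosedEmbedding_lineProj.isInducing.continuous_iff]
  have hL : Continuous fun p : SL d × Proj d => lineProj p.2 := continuous_lineProj.comp continuous_snd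
  have hg : Continuous fun p : SL d × Proj d => p.1.1 := by fun_prop
  have ha : Continuous fun p : SL d × Proj d => ContinuousLinearMap.adjoint p.1.1 :=
    (ContinuousLinearMap.adjoint (𝕜 := ℝ) (E := Vec d) (F := Vec d)).continuous.comp hg
  have : (lineProj ∘ fun p : SL d × Proj d => act p.1 p.2) = fun p =>
      (‖p.1.1.comp (lineProj p.2)‖ ^ 2)⁻¹ •
      (p.1.1.comp ((lineProj p.2).comp (ContinuousLinearMap.adjoint p.1.1))) := by
    funext p
    exact lineProj_act p.1 p.2
  rw [this]
  refine Continuous.smul (Continuous.inv₀ ((hg.clm_comp hL).norm.pow 2) fun p => ?_)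
    (hg.clm_comp (hL.clm_comp ha))
  have : p.1.1.comp (lineProj p.2) ≠ 0 := by
    intro h
    refine lineProj_ne_zero p.2 ?_
    ext1 w
    exact injective_of_det_eq_one p.1.2 (by simpa using DFunLike.congr_fun h w)
  exact pow_ne_zero 2 (norm_ne_zero_iff.2 this)

theorem continuous_act_right {d : ℕ} (g : SL d) : Continuous (act g) :=
  continuous_act.comp (Continuous.prodMk_right g)

/-- The push-forward of a probability measure under the projective action. -/
noncomputable def push {d : ℕ} (g : SL d) (m : ProbabilityMeasure (Proj d)) :
    ProbabilityMeasure (Proj d) :=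
  m.map (continuous_act_right g).measurable.aemeasurable

theorem coe_push {d : ℕ} (g : SL d) (m : ProbabilityMeasure (Proj d)) :
    (push g m : Measure (Proj d)) = (m : Measure (Proj d)).map (act g) := rfl

/-- Projective space is compact, so `y ↦ F (y, ·)` is continuous for the sup norm. The variation
splits into a uniformly small part and a weak convergence part with `y₀` fixed. -/
theorem continuous_integral_proj {d : ℕ} {Y : Type*} [TopologicalSpace Y] {F : Y × Proj d → ℝ}
    (hF : Continuous F) :
    Continuous fun p : Y × ProbabilityMeasure (Proj d) =>
      ∫ x, F (p.1, x) ∂(p.2 : Measure (Proj d)) := by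
  rw [continuous_iff_continuousAt]
  rintro ⟨y₀, m₀⟩
  let C : C(Y, C(Proj d, ℝ)) := ContinuousMap.curry ⟨F, hF⟩
  have hint : ∀ (m : ProbabilityMeasure (Proj d)) (u : C(Proj d, ℝ)),
      Integrable u (m : Measure (Proj d)) := fun m u =>
    (BoundedContinuousFunction.mkOfCompact u).integrable _
  have h0 : Tendsto (fun p : Y × ProbabilityMeasure (Proj d) =>
      ∫ x, C y₀ x ∂(p.2 : Measure (Proj d))) (𝓝 (y₀, m₀))
      (𝓝 (∫ x, C y₀ x ∂(m₀ : Measure (Proj d)))) :=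
    (ProbabilityMeasure.tendsto_iff_forall_integral_tendsto.1
      (continuous_snd.tendsto (y₀, m₀))) (BoundedContinuousFunction.mkOfCompact (C y₀))
  have h1 : Tendsto (fun p : Y × ProbabilityMeasure (Proj d) =>
      ∫ x, C p.1 x ∂(p.2 : Measure (Proj d)) - ∫ x, C y₀ x ∂(p.2 : Measure (Proj d)))
      (𝓝 (y₀, m₀)) (𝓝 0) := by
    have hn : Tendsto (fun p : Y × ProbabilityMeasure (Proj d) => ‖C p.1 - C y₀‖)
        (𝓝 (y₀, m₀)) (𝓝 0) := by
      have : Continuous fun p : Y × ProbabilityMeasure (Proj d) => ‖C p.1 - C y₀‖ :=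
        ((C.continuous.comp continuous_fst).sub continuous_const).norm
      simpa using this.tendsto (y₀, m₀)
    refine squeeze_zero_norm (fun p => ?_) hn
    rw [← integral_sub (hint _ _) (hint _ _)]
    have := norm_integral_le_of_norm_le_const (μ := (p.2 : Measure (Proj d)))
      (f := fun x => C p.1 x - C y₀ x) (C := ‖C p.1 - C y₀‖)
      (Eventually.of_forall fun x => (C p.1 - C y₀).norm_coe_le_norm x)
    simpa using this
  have h2 := h1.add h0
  simp only [sub_add_cancel, zero_add] at h2
  exact h2

theorem continuous_push {d : ℕ} :
    Continuous fun p : SL d × ProbabilityMeasure (Proj d) => push p.1 p.2 := by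
  rw [continuous_iff_continuousAt]
  rintro ⟨g₀, m₀⟩
  rw [ContinuousAt, ProbabilityMeasure.tendsto_iff_forall_integral_tendsto]
  intro f
  have hF : ∀ p : SL d × ProbabilityMeasure (Proj d),
      ∫ x, f x ∂(push p.1 p.2 : Measure (Proj d)) =
        ∫ x, f (act p.1 x) ∂(p.2 : Measure (Proj d)) := fun p => by
    rw [coe_push, integral_map (continuous_act_right p.1).measurable.aemeasurable
      f.continuous.aestronglyMeasurable]
  have h := (continuous_integral_proj (f.continuous.comp (continuous_act (d := d)))).tendsto
    (g₀, m₀)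
  simp only [Function.comp_apply] at h
  simp only [hF]
  rw [hF (g₀, m₀)]
  exact h

theorem push_comp {d : ℕ} (g h : SL d) (hgh : (g.1.comp h.1).det = 1)
    (m : ProbabilityMeasure (Proj d)) : push ⟨g.1.comp h.1, hgh⟩ m = push g (push h m) := by
  apply Subtype.ext
  change (push _ m : Measure (Proj d)) = (push g (push h m) : Measure (Proj d))
  rw [coe_push, coe_push, coe_push, Measure.map_map (continuous_act_right g).measurable
    (continuous_act_right h).measurable]
  congr 1
  funext x
  apply Projectivization.submodule_injective
  rw [Function.comp_apply, submodule_act, submodule_act, submodule_act, ← Submodule.map_comp]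
  rfl

theorem isUnit_of_det_eq_one {d : ℕ} {g : Mat d} (h : g.det = 1) : IsUnit g := by
  have hi := injective_of_det_eq_one h
  let e := LinearEquiv.ofInjectiveEndo (g : Vec d →ₗ[ℝ] Vec d) hi
  refine ⟨⟨g, e.toContinuousLinearEquiv.symm, ?_, ?_⟩, rfl⟩
  · ext1 w
    exact e.apply_symm_apply w
  · ext1 w
    exact e.symm_apply_apply w

/-- The inverse in `SL_d`. -/
noncomputable def SL.inv {d : ℕ} (g : SL d) : SL d :=
  ⟨Ring.inverse g.1, by
    have h := det_comp (Ring.inverse g.1) g.1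
    have h2 : (Ring.inverse g.1).comp g.1 = 1 :=
      Ring.inverse_mul_cancel _ (isUnit_of_det_eq_one g.2)
    rw [h2, g.2, mul_one] at h
    rw [← h]
    exact LinearMap.det_id⟩

theorem SL.inv_comp {d : ℕ} (g : SL d) : g.inv.1.comp g.1 = ContinuousLinearMap.id ℝ (Vec d) :=
  Ring.inverse_mul_cancel _ (isUnit_of_det_eq_one g.2)

theorem SL.comp_inv {d : ℕ} (g : SL d) : g.1.comp g.inv.1 = ContinuousLinearMap.id ℝ (Vec d) :=
  Ring.mul_inverse_cancel _ (isUnit_of_det_eq_one g.2)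

theorem SL.continuous_inv {d : ℕ} : Continuous (SL.inv : SL d → SL d) := by
  refine Continuous.subtype_mk ?_ _
  rw [continuous_iff_continuousAt]
  intro g
  obtain ⟨u, hu⟩ := isUnit_of_det_eq_one g.2
  have := NormedRing.inverse_continuousAt u
  rw [hu] at this
  exact ContinuousAt.comp this continuous_subtype_val.continuousAt

theorem push_inv_push {d : ℕ} (g : SL d) (m : ProbabilityMeasure (Proj d)) :
    push g.inv (push g m) = m := by
  rw [← push_comp _ _ (by rw [det_comp, g.2, g.inv.2, one_mul])]
  apply Subtype.ext
  change (push _ m : Measure (Proj d)) = m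
  rw [coe_push]
  convert Measure.map_id
  funext x
  apply Projectivization.submodule_injective
  rw [submodule_act]
  simp [SL.inv_comp]

/-! ### Measures carried by finitely many subspaces -/

/-- Almost every line lies in one of the subspaces `E i`. -/
def CarriedBy {d p : ℕ} (m : ProbabilityMeasure (Proj d)) (E : Fin p → Submodule ℝ (Vec d)) :
    Prop :=
  ∀ᵐ x ∂(m : Measure (Proj d)), ∃ i, x.submodule ≤ E i

/-- The measure is carried by finitely many proper subspaces. -/
def Degenerate {d : ℕ} (m : ProbabilityMeasure (Proj d)) : Prop :=
  ∃ (p : ℕ) (E : Fin p → Submodule ℝ (Vec d)),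
    (∀ i, Module.finrank ℝ (E i) < d) ∧ CarriedBy m E

/-- The projections onto the members of a family of subspaces. -/
noncomputable def proj {d p : ℕ} (E : Fin p → Submodule ℝ (Vec d)) : Fin p → Mat d :=
  fun i => (E i).starProjection

/-- A function that vanishes if and only if some `Q i` fixes the range of `L`. -/
noncomputable def gap {d p : ℕ} (Q : Fin p → Mat d) (L : Mat d) : ℝ :=
  ∏ i, ‖L - (Q i).comp L‖

theorem gap_nonneg {d p : ℕ} (Q : Fin p → Mat d) (L : Mat d) : 0 ≤ gap Q L :=
  Finset.prod_nonneg fun _ _ => norm_nonneg _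

theorem gap_eq_zero_of_comp_eq {d p : ℕ} {Q : Fin p → Mat d} {L : Mat d} (i : Fin p)
    (h : (Q i).comp L = L) : gap Q L = 0 :=
  Finset.prod_eq_zero (Finset.mem_univ i) (by rw [h, sub_self, norm_zero])

theorem continuous_gap {d p : ℕ} : Continuous fun q : (Fin p → Mat d) × Mat d => gap q.1 q.2 := by
  unfold gap
  refine continuous_finsetProd _ fun i _ => ?_
  have h1 : Continuous fun q : (Fin p → Mat d) × Mat d => q.1 i := by fun_prop
  exact (continuous_snd.sub (h1.clm_comp continuous_snd)).norm

attribute [local irreducible] gap in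
theorem continuous_gap_lineProj {d p : ℕ} :
    Continuous fun q : (Fin p → Mat d) × Proj d => gap q.1 (lineProj q.2) := by
  have h : Continuous fun q : (Fin p → Mat d) × Proj d => (q.1, lineProj q.2) :=
    continuous_fst.prodMk (continuous_lineProj.comp continuous_snd)
  have h' := continuous_gap.comp h
  exact h'

attribute [local irreducible] gap in
theorem continuous_gap_right {d p : ℕ} (Q : Fin p → Mat d) :
    Continuous fun x : Proj d => gap Q (lineProj x) := by
  have h : Continuous fun x : Proj d => (Q, lineProj x) :=
    continuous_const.prodMk continuous_lineProj
  have h' := continuous_gap.comp h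
  exact h'

theorem gap_eq_zero_iff {d p : ℕ} (E : Fin p → Submodule ℝ (Vec d)) (x : Proj d) :
    gap (proj E) (lineProj x) = 0 ↔ ∃ i, x.submodule ≤ E i := by
  simp only [gap, Finset.prod_eq_zero_iff, Finset.mem_univ, true_and, norm_eq_zero, sub_eq_zero,
    submodule_le_iff_comp_lineProj, proj]
  simp only [eq_comm]

theorem gap_proj_le {d p : ℕ} (E : Fin p → Submodule ℝ (Vec d)) (x : Proj d) :
    gap (proj E) (lineProj x) ≤ 2 ^ p := by
  have : ∀ i, ‖lineProj x - (proj E i).comp (lineProj x)‖ ≤ 2 := fun i => by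
    have h1 := norm_lineProj_le x
    have h2 : ‖proj E i‖ ≤ 1 := Submodule.starProjection_norm_le _
    have h3 := (proj E i).opNorm_comp_le (lineProj x)
    have h4 := norm_sub_le (lineProj x) ((proj E i).comp (lineProj x))
    nlinarith [norm_nonneg (proj E i), norm_nonneg (lineProj x)]
  unfold gap
  calc _ ≤ ∏ _i : Fin p, (2 : ℝ) := Finset.prod_le_prod (fun _ _ => norm_nonneg _) fun i _ => this i
    _ = 2 ^ p := by simp

/-- The gap is nonnegative and vanishes exactly on the lines inside some `E i`. Being carried thus
becomes one equation, closed under joint limits of measure and subspaces. -/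
theorem carriedBy_iff_integral {d p : ℕ} (m : ProbabilityMeasure (Proj d))
    (E : Fin p → Submodule ℝ (Vec d)) :
    CarriedBy m E ↔ ∫ x, gap (proj E) (lineProj x) ∂(m : Measure (Proj d)) = 0 := by
  have hc := continuous_gap_right (proj E)
  have hi : Integrable (fun x : Proj d => gap (proj E) (lineProj x)) (m : Measure (Proj d)) :=
    (BoundedContinuousFunction.mkOfCompact ⟨_, hc⟩).integrable _
  rw [integral_eq_zero_iff_of_nonneg (fun x => gap_nonneg _ _) hi]
  simp only [CarriedBy, ← gap_eq_zero_iff]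
  rfl

theorem CarriedBy.push {d p : ℕ} {m : ProbabilityMeasure (Proj d)}
    {E : Fin p → Submodule ℝ (Vec d)} (h : CarriedBy m E) (g : SL d) :
    CarriedBy (push g m) fun i => (E i).map (g.1 : Vec d →ₗ[ℝ] Vec d) := by
  rw [carriedBy_iff_integral, coe_push, integral_map (continuous_act_right g).measurable.aemeasurable
    (continuous_gap_right _).aestronglyMeasurable]
  refine integral_eq_zero_of_ae ?_
  filter_upwards [h] with x ⟨i, hi⟩
  refine (gap_eq_zero_iff _ _).2 ⟨i, ?_⟩
  rw [submodule_act]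
  exact Submodule.map_mono hi

theorem finrank_map_SL {d : ℕ} (g : SL d) (V : Submodule ℝ (Vec d)) :
    Module.finrank ℝ (V.map (g.1 : Vec d →ₗ[ℝ] Vec d)) = Module.finrank ℝ V :=
  (Submodule.equivMapOfInjective (g.1 : Vec d →ₗ[ℝ] Vec d)
    (injective_of_det_eq_one g.2) V).finrank_eq.symm

/-- The dimension of a subspace is the trace of its projection. -/
theorem trace_starProjection {d : ℕ} (V : Submodule ℝ (Vec d)) :
    LinearMap.trace ℝ (Vec d) (V.starProjection : Vec d →ₗ[ℝ] Vec d) = Module.finrank ℝ V := by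
  refine LinearMap.IsProj.trace ⟨fun x => ?_, fun x hx => ?_⟩
  · exact Submodule.starProjection_apply_mem _ _
  · exact Submodule.starProjection_eq_self_iff.2 hx

/-- Idempotent and self-adjoint are closed conditions, and the trace, which counts the dimension, is
continuous. This is the closedness behind compactness of the Grassmannian. -/
theorem exists_starProjection_of_tendsto {d k : ℕ} {V : ℕ → Submodule ℝ (Vec d)} {Q : Mat d}
    (hk : ∀ n, Module.finrank ℝ (V n) = k)
    (h : Tendsto (fun n => (V n).starProjection) atTop (𝓝 Q)) :
    ∃ W : Submodule ℝ (Vec d), Module.finrank ℝ W = k ∧ Q = W.starProjection := by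
  have hcl : IsClosed {q : Mat d | q.comp q = q ∧ ContinuousLinearMap.adjoint q = q} := by
    refine (isClosed_eq (continuous_id.clm_comp continuous_id) continuous_id).inter ?_
    exact isClosed_eq (ContinuousLinearMap.adjoint (𝕜 := ℝ) (E := Vec d) (F := Vec d)).continuous
      continuous_id
  have hQ : Q ∈ {q : Mat d | q.comp q = q ∧ ContinuousLinearMap.adjoint q = q} := by
    refine hcl.mem_of_tendsto h (Eventually.of_forall fun n => ?_)
    have := isStarProjection_iff_eq_starProjection.2 ⟨V n, inferInstance, rfl⟩
    exact ⟨this.isIdempotentElem, this.isSelfAdjoint⟩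
  have hs : IsStarProjection Q := ⟨hQ.1, hQ.2⟩
  obtain ⟨W, _, hW⟩ := isStarProjection_iff_eq_starProjection.1 hs
  refine ⟨W, ?_, hW⟩
  have hc : Continuous fun q : Mat d => LinearMap.trace ℝ (Vec d) (q : Vec d →ₗ[ℝ] Vec d) :=
    ((LinearMap.trace ℝ (Vec d)).comp
      (ContinuousLinearMap.coeLM ℝ : Mat d →ₗ[ℝ] Vec d →ₗ[ℝ] Vec d)).continuous_of_finiteDimensional
  have h1 := (hc.tendsto Q).comp h
  have h2 : (fun q : Mat d => LinearMap.trace ℝ (Vec d) (q : Vec d →ₗ[ℝ] Vec d)) ∘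
      (fun n => (V n).starProjection) = fun _ => (k : ℝ) := by
    funext n
    simp only [Function.comp_apply]
    rw [trace_starProjection, hk]
  rw [h2] at h1
  have h3 := tendsto_nhds_unique h1 tendsto_const_nhds
  have h4 : LinearMap.trace ℝ (Vec d) (Q : Vec d →ₗ[ℝ] Vec d) = Module.finrank ℝ W := by
    subst hW
    exact trace_starProjection W
  rw [h4] at h3
  exact_mod_cast h3

theorem exists_subseq_tendsto_proj {d p : ℕ} {δ : Fin p → ℕ} (E : ℕ → Fin p → Submodule ℝ (Vec d))
    (hE : ∀ n i, Module.finrank ℝ (E n i) = δ i) :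
    ∃ (F : Fin p → Submodule ℝ (Vec d)) (φ : ℕ → ℕ), StrictMono φ ∧
      (∀ i, Module.finrank ℝ (F i) = δ i) ∧ Tendsto (fun n => proj (E (φ n))) atTop (𝓝 (proj F)) := by
  have hb : ∀ n, proj (E n) ∈ Metric.closedBall (0 : Fin p → Mat d) 1 := fun n => by
    rw [mem_closedBall_zero_iff, pi_norm_le_iff_of_nonneg zero_le_one]
    exact fun i => Submodule.starProjection_norm_le _
  obtain ⟨Q, -, φ, hφ, hQ⟩ := tendsto_subseq_of_bounded Metric.isBounded_closedBall hb
  have := fun i => exists_starProjection_of_tendsto (fun n => hE (φ n) i)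
    ((tendsto_pi_nhds.1 hQ) i)
  choose F hF hFQ using this
  refine ⟨F, φ, hφ, hF, ?_⟩
  have : proj F = Q := funext fun i => (hFQ i).symm
  rw [this]
  exact hQ

theorem carriedBy_of_tendsto {d p : ℕ} {E : ℕ → Fin p → Submodule ℝ (Vec d)}
    {F : Fin p → Submodule ℝ (Vec d)} {m : ℕ → ProbabilityMeasure (Proj d)}
    {m' : ProbabilityMeasure (Proj d)} (hm : Tendsto m atTop (𝓝 m'))
    (hE : Tendsto (fun n => proj (E n)) atTop (𝓝 (proj F))) (hc : ∀ n, CarriedBy (m n) (E n)) :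
    CarriedBy m' F := by
  rw [carriedBy_iff_integral]
  have h := ((continuous_integral_proj (continuous_gap_lineProj (d := d) (p := p))).tendsto
    (proj F, m')).comp (hE.prodMk_nhds hm)
  refine tendsto_nhds_unique h ?_
  refine tendsto_const_nhds.congr fun n => ?_
  exact ((carriedBy_iff_integral _ _).1 (hc n)).symm

theorem exists_subseq_carriedBy {d p : ℕ} {δ : Fin p → ℕ} {m : ℕ → ProbabilityMeasure (Proj d)}
    {m' : ProbabilityMeasure (Proj d)} (hm : Tendsto m atTop (𝓝 m'))
    (E : ℕ → Fin p → Submodule ℝ (Vec d)) (hE : ∀ n i, Module.finrank ℝ (E n i) = δ i)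
    (hc : ∀ n, CarriedBy (m n) (E n)) :
    ∃ (F : Fin p → Submodule ℝ (Vec d)) (φ : ℕ → ℕ), StrictMono φ ∧
      (∀ i, Module.finrank ℝ (F i) = δ i) ∧ CarriedBy m' F ∧
      Tendsto (fun n => proj (E (φ n))) atTop (𝓝 (proj F)) := by
  obtain ⟨F, φ, hφ, hF, h⟩ := exists_subseq_tendsto_proj E hE
  exact ⟨F, φ, hφ, hF, carriedBy_of_tendsto (hm.comp hφ.tendsto_atTop) h fun n => hc _, h⟩

/-! ### Furstenberg's compactness lemma -/

theorem lineProj_act_smul {d : ℕ} (g : SL d) (x : Proj d) {c : ℝ} (hc : c ≠ 0) :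
    lineProj (act g x) = (‖(c • g.1).comp (lineProj x)‖ ^ 2)⁻¹ •
      ((c • g.1).comp ((lineProj x).comp (ContinuousLinearMap.adjoint (c • g.1)))) := by
  rw [lineProj_act, ContinuousLinearMap.smul_comp, norm_smul, map_smulₛₗ,
    ContinuousLinearMap.comp_smulₛₗ, ContinuousLinearMap.smul_comp, ContinuousLinearMap.comp_smulₛₗ,
    smul_smul, smul_smul]
  congr 1
  simp only [Real.norm_eq_abs, mul_pow, sq_abs, mul_inv, RingHom.id_apply, conj_trivial]
  field_simp

attribute [local irreducible] gap in
-- Lines outside the kernel `N` of `u` are moved towards the range `R` of `u`; lines inside `N` stay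
-- in `g n N`, which subconverges to a subspace of the same dimension. The limit measure is
-- therefore carried by two subspaces, both proper because `u` is nonzero and singular.
theorem degenerate_of_tendsto_push {d : ℕ} {m m' : ProbabilityMeasure (Proj d)} {g : ℕ → SL d}
    {c : ℕ → ℝ} {u : Mat d} (hc : ∀ n, c n ≠ 0) (hu : Tendsto (fun n => c n • (g n).1) atTop (𝓝 u))
    (hu0 : u ≠ 0) (hdet : u.det = 0) (h : Tendsto (fun n => push (g n) m) atTop (𝓝 m')) :
    Degenerate m' := by
  set N : Submodule ℝ (Vec d) := LinearMap.ker (u : Vec d →ₗ[ℝ] Vec d) with hN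
  set R : Submodule ℝ (Vec d) := LinearMap.range (u : Vec d →ₗ[ℝ] Vec d) with hR
  have hNd : Module.finrank ℝ N < d := by
    have h1 : N ≠ ⊤ := by
      intro h
      rw [hN, LinearMap.ker_eq_top] at h
      exact hu0 (ContinuousLinearMap.coe_injective h)
    simpa using Submodule.finrank_lt h1
  have hRd : Module.finrank ℝ R < d := by
    have h1 : R ≠ ⊤ := (LinearMap.range_lt_top_of_det_eq_zero hdet).ne
    simpa using Submodule.finrank_lt h1
  let E : ℕ → Fin 2 → Submodule ℝ (Vec d) := fun n =>
    ![R, N.map ((g n).1 : Vec d →ₗ[ℝ] Vec d)]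
  have hE : ∀ n i, Module.finrank ℝ (E n i) = ![Module.finrank ℝ R, Module.finrank ℝ N] i := by
    intro n i
    fin_cases i
    · rfl
    · exact finrank_map_SL (g n) N
  obtain ⟨F, φ, hφ, hF, hEF⟩ := exists_subseq_tendsto_proj E hE
  refine ⟨2, F, fun i => ?_, ?_⟩
  · rw [hF]
    fin_cases i
    · exact hRd
    · exact hNd
  rw [carriedBy_iff_integral]
  have h1 := ((continuous_integral_proj (continuous_gap_lineProj (d := d) (p := 2))).tendsto
    (proj F, m')).comp (hEF.prodMk_nhds (h.comp hφ.tendsto_atTop))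
  refine tendsto_nhds_unique h1 ?_
  have h2 : ∀ n, ∫ x, gap (proj (E (φ n))) (lineProj x) ∂(push (g (φ n)) m : Measure (Proj d)) =
      ∫ x, gap (proj (E (φ n))) (lineProj (act (g (φ n)) x)) ∂(m : Measure (Proj d)) := fun n => by
    rw [coe_push, integral_map (continuous_act_right _).measurable.aemeasurable
      (continuous_gap_right _).aestronglyMeasurable]
  change Tendsto (fun n => ∫ x, gap (proj (E (φ n))) (lineProj x)
    ∂(push (g (φ n)) m : Measure (Proj d))) atTop (𝓝 0)
  simp only [h2]
  rw [← integral_zero (Proj d) ℝ (μ := (m : Measure (Proj d)))]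
  refine tendsto_integral_of_dominated_convergence (fun _ => 2 ^ 2) (fun n => ?_)
    (integrable_const _) (fun n => Eventually.of_forall fun x => ?_)
    (Eventually.of_forall fun x => ?_)
  · exact ((continuous_gap_right (proj (E (φ n)))).comp
      (continuous_act_right (g (φ n)))).aestronglyMeasurable
  · rw [Real.norm_of_nonneg (gap_nonneg _ _)]
    exact gap_proj_le _ _
  by_cases hx : x.submodule ≤ N
  · refine tendsto_const_nhds.congr fun n => ?_
    symm
    rw [gap_eq_zero_iff]
    refine ⟨1, ?_⟩
    rw [submodule_act]
    exact Submodule.map_mono hx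
  · have hL : u.comp (lineProj x) ≠ 0 := by
      intro h0
      apply hx
      intro v hv
      have := DFunLike.congr_fun h0 v
      rw [ContinuousLinearMap.comp_apply, show lineProj x v = v from
        Submodule.starProjection_eq_self_iff.2 hv] at this
      exact this
    have hu' := hu.comp hφ.tendsto_atTop
    -- The projective action written for arbitrary matrices; it is continuous at `u` because `u`
    -- does not kill the line `x`.
    let B : Mat d → Mat d := fun q => (‖q.comp (lineProj x)‖ ^ 2)⁻¹ •
      (q.comp ((lineProj x).comp (ContinuousLinearMap.adjoint q)))
    have hB : ContinuousAt B u := by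
      have ha : Continuous fun q : Mat d => ContinuousLinearMap.adjoint q :=
        (ContinuousLinearMap.adjoint (𝕜 := ℝ) (E := Vec d) (F := Vec d)).continuous
      have hb1 : Continuous fun q : Mat d => q.comp (lineProj x) :=
        continuous_id.clm_comp continuous_const
      have hb2 : Continuous fun q : Mat d => ‖q.comp (lineProj x)‖ ^ 2 := hb1.norm.pow 2
      have hb3 : ContinuousAt (fun q : Mat d => (‖q.comp (lineProj x)‖ ^ 2)⁻¹) u :=
        ContinuousAt.inv₀ hb2.continuousAt (pow_ne_zero 2 (norm_ne_zero_iff.2 hL))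
      have hb4 : Continuous fun q : Mat d =>
          q.comp ((lineProj x).comp (ContinuousLinearMap.adjoint q)) :=
        continuous_id.clm_comp (continuous_const.clm_comp ha)
      exact hb3.smul hb4.continuousAt
    have h3 : Tendsto (fun n => lineProj (act (g (φ n)) x)) atTop (𝓝 (B u)) := by
      refine (hB.tendsto.comp hu').congr fun n => ?_
      exact (lineProj_act_smul (g (φ n)) x (hc _)).symm
    have h4 := (continuous_gap.tendsto (proj F, B u)).comp (hEF.prodMk_nhds h3)
    have hF0 : F 0 = R := by
      have := tendsto_nhds_unique ((tendsto_pi_nhds.1 hEF) 0)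
        (tendsto_const_nhds (x := R.starProjection))
      exact Submodule.starProjection_inj.1 this
    have h5 : gap (proj F) (B u) = 0 := by
      refine gap_eq_zero_of_comp_eq 0 ?_
      ext1 w
      simp only [proj, hF0]
      refine Submodule.starProjection_eq_self_iff.2 (Submodule.smul_mem _ _ ?_)
      exact ⟨_, rfl⟩
    simp only [h5] at h4
    exact h4

/-- If the norms do not tend to infinity, some subsequence is bounded and its limit points have
determinant one. Otherwise the normalized matrices subconverge to a `u` of norm one with `det u =
lim ‖g n‖⁻ᵈ = 0`, which would force a degenerate limit. -/
theorem exists_subseq_tendsto_of_push {d : ℕ} {m m' : ProbabilityMeasure (Proj d)} {g : ℕ → SL d}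
    (h : Tendsto (fun n => push (g n) m) atTop (𝓝 m')) (hm' : ¬ Degenerate m') :
    ∃ (q : SL d) (φ : ℕ → ℕ), StrictMono φ ∧ Tendsto (g ∘ φ) atTop (𝓝 q) := by
  by_cases hb : ∃ R : ℝ, ∃ᶠ n in atTop, (g n).1 ∈ Metric.closedBall (0 : Mat d) R
  · obtain ⟨R, hR⟩ := hb
    obtain ⟨q, -, φ, hφ, hq⟩ := tendsto_subseq_of_frequently_bounded Metric.isBounded_closedBall hR
    have hdet : q.det = 1 := by
      have := (ContinuousLinearMap.continuous_det.tendsto q).comp hq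
      refine tendsto_nhds_unique this (tendsto_const_nhds.congr fun n => ?_)
      exact (g (φ n)).2.symm
    exact ⟨⟨q, hdet⟩, φ, hφ, tendsto_subtype_rng.2 hq⟩
  exfalso
  apply hm'
  push Not at hb
  have hinf : Tendsto (fun n => ‖(g n).1‖) atTop atTop := by
    refine tendsto_atTop.2 fun R => ?_
    filter_upwards [hb R] with n hn
    rw [mem_closedBall_zero_iff] at hn
    exact (not_le.1 hn).le
  -- Shifting the index by `n₀` makes all norms positive, so that normalizing is legitimate.
  obtain ⟨n₀, hn₀⟩ := eventually_atTop.1 (hinf.eventually_ge_atTop 1)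
  have hpos : ∀ n, 0 < ‖(g (n + n₀)).1‖ := fun n =>
    lt_of_lt_of_le one_pos (hn₀ _ (Nat.le_add_left _ _))
  have hbd : ∀ n, (‖(g (n + n₀)).1‖⁻¹ • (g (n + n₀)).1) ∈ Metric.sphere (0 : Mat d) 1 := fun n => by
    rw [mem_sphere_zero_iff_norm, norm_smul, norm_inv, norm_norm, inv_mul_cancel₀ (hpos n).ne']
  obtain ⟨u, hu1, φ, hφ, hu⟩ := tendsto_subseq_of_bounded Metric.isBounded_sphere hbd
  rw [Metric.isClosed_sphere.closure_eq, mem_sphere_zero_iff_norm] at hu1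
  have hu0 : u ≠ 0 := norm_ne_zero_iff.1 (by rw [hu1]; exact one_ne_zero)
  have hφ' : Tendsto (fun n => φ n + n₀) atTop atTop :=
    (tendsto_add_atTop_nat n₀).comp hφ.tendsto_atTop
  refine degenerate_of_tendsto_push (c := fun n => ‖(g (φ n + n₀)).1‖⁻¹)
    (g := fun n => g (φ n + n₀)) (u := u) (m := m) (fun n => (inv_pos.2 (hpos _)).ne') hu hu0 ?_
    (h.comp hφ')
  have hd : d ≠ 0 := by
    rintro rfl
    exact hu0 (Subsingleton.elim _ _)
  have h1 := (ContinuousLinearMap.continuous_det.tendsto u).comp hu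
  refine tendsto_nhds_unique h1 ?_
  have h2 : ∀ n, (‖(g (φ n + n₀)).1‖⁻¹ • (g (φ n + n₀)).1).det = ‖(g (φ n + n₀)).1‖⁻¹ ^ d := by
    intro n
    have := LinearMap.det_smul ‖(g (φ n + n₀)).1‖⁻¹ ((g (φ n + n₀)).1 : Vec d →ₗ[ℝ] Vec d)
    have hg : LinearMap.det ((g (φ n + n₀)).1 : Vec d →ₗ[ℝ] Vec d) = 1 := (g (φ n + n₀)).2
    rw [hg, finrank_euclideanSpace, Fintype.card_fin, mul_one] at this
    exact this
  have h3 : Tendsto (fun n => ‖(g (φ n + n₀)).1‖⁻¹ ^ d) atTop (𝓝 0) := by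
    have := ((tendsto_inv_atTop_zero.comp (hinf.comp hφ')).pow d)
    rw [zero_pow hd] at this
    exact this
  exact h3.congr fun n => (h2 n).symm

/-! ### Pairs that preserve the fiber measures -/

theorem CUB.continuous_eval {V W : Type*} [MetricSpace V] [MetricSpace W] (v : V) :
    Continuous fun f : CUB V W => f v := by
  have h1 : Continuous fun f : CUB V W =>
      UniformOnFun.ofFun {U : Set V | Bornology.IsBounded U} f.toFun := continuous_induced_dom
  have h2 := (UniformOnFun.uniformContinuous_eval_of_mem W {U : Set V | Bornology.IsBounded U}
    (mem_singleton v) Bornology.isBounded_singleton).continuous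
  exact h2.comp h1

/-- The pairs `(T, A)` for which `A` pushes the measures `ν` over `X` forward along `T`. -/
def preservers {Z : Type*} [MetricSpace Z] {d : ℕ} (X : Set Z) (ν : Z → ProbabilityMeasure (Proj d)) :
    Set (CUB Z Z × CUB Z (Mat d)) :=
  {c | ∀ z ∈ X, c.1 z ∈ X ∧ ∃ h : (c.2 z).det = 1, push ⟨c.2 z, h⟩ (ν z) = ν (c.1 z)}

theorem isClosed_preservers {Z : Type*} [MetricSpace Z] {d : ℕ} {X : Set Z} (hX : IsClosed X)
    {ν : Z → ProbabilityMeasure (Proj d)} (hν : ContinuousOn ν X) :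
    IsClosed (preservers X ν) := by
  refine isClosed_of_closure_subset fun c hc z hz => ?_
  have hne := mem_closure_iff_comap_neBot.1 hc
  set l : Filter (preservers X ν) := comap (↑) (𝓝 c)
  have hl : Tendsto (fun c' : preservers X ν => c'.1) l (𝓝 c) := tendsto_comap
  have h1 : Tendsto (fun c' : preservers X ν => c'.1.1 z) l (𝓝 (c.1 z)) :=
    (((CUB.continuous_eval z).comp continuous_fst).tendsto c).comp hl
  have h2 : Tendsto (fun c' : preservers X ν => c'.1.2 z) l (𝓝 (c.2 z)) :=
    (((CUB.continuous_eval z).comp continuous_snd).tendsto c).comp hl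
  have h3 : c.1 z ∈ X := hX.mem_of_tendsto h1 (Eventually.of_forall fun c' => (c'.2 z hz).1)
  have h4 : (c.2 z).det = 1 := by
    refine tendsto_nhds_unique ((ContinuousLinearMap.continuous_det.tendsto _).comp h2)
      (tendsto_const_nhds.congr fun c' => ?_)
    exact (c'.2 z hz).2.1.symm
  refine ⟨h3, h4, ?_⟩
  let q : preservers X ν → SL d := fun c' => ⟨c'.1.2 z, (c'.2 z hz).2.1⟩
  have h5 : Tendsto q l (𝓝 ⟨c.2 z, h4⟩) := tendsto_subtype_rng.2 h2
  have h6 : Tendsto (fun c' => push (q c') (ν z)) l (𝓝 (push ⟨c.2 z, h4⟩ (ν z))) :=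
    (continuous_push.tendsto (⟨c.2 z, h4⟩, ν z)).comp (h5.prodMk_nhds tendsto_const_nhds)
  have h7 : Tendsto (fun c' : preservers X ν => ν (c'.1.1 z)) l (𝓝 (ν (c.1 z))) :=
    (hν _ h3).tendsto.comp (tendsto_nhdsWithin_iff.2
      ⟨h1, Eventually.of_forall fun c' => (c'.2 z hz).1⟩)
  exact tendsto_nhds_unique h6 (h7.congr fun c' => (c'.2 z hz).2.2.symm)

theorem mem_closure_of_ae {Z : Type*} [TopologicalSpace Z] [MeasurableSpace Z] {μ : Measure Z}
    {s : Set Z} (hs : ∀ᵐ z ∂μ, z ∈ s) {z : Z} (hz : z ∈ μ.support) : z ∈ closure s := by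
  rw [mem_closure_iff_nhds]
  intro U hU
  have h1 := (Measure.mem_support_iff_forall z).1 hz U hU
  by_contra h
  have h2 : U ⊆ sᶜ := fun x hx hxs => h ⟨x, hx, hxs⟩
  exact h1.ne' (measure_mono_null h2 hs)

section Measurability

variable {Ω : Type*} [MeasurableSpace Ω] {P : Measure Ω} {θ : Semiflow P}
  {Z : Type*} [MetricSpace Z] [MeasurableSpace Z]

theorem measurable_timeMap_uncurry (T : ContinuousRDS θ Z) (t : ℝ≥0) :
    Measurable fun p : Z × Ω => T.timeMap t p.2 p.1 :=
  T.measurable_eval.comp (measurable_const.prodMk (measurable_snd.prodMk measurable_fst))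

theorem measurable_timeMap (T : ContinuousRDS θ Z) (t : ℝ≥0) (z : Z) :
    Measurable fun ω => T.timeMap t ω z :=
  (measurable_timeMap_uncurry T t).comp (measurable_const.prodMk measurable_id)

end Measurability

/-! ### Rigidity: from almost sure invariance to the whole support -/

section Cocycle

variable {Ω : Type*} [MeasurableSpace Ω] {P : Measure Ω} [IsProbabilityMeasure P] {θ : Semiflow P}
  {Z : Type*} [MetricSpace Z] [SecondCountableTopology Z] [MeasurableSpace Z] [BorelSpace Z]
  {T : ContinuousRDS θ Z} {μ : Measure Z} [IsProbabilityMeasure μ] {d : ℕ}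

theorem ae_timeMap_mem_support (hμ : T.Stationary μ) (t : ℝ≥0) :
    ∀ᵐ ω ∂P, ∀ᵐ z ∂μ, T.timeMap t ω z ∈ μ.support := by
  have hm : MeasurableSet (μ.support)ᶜ := Measure.isClosed_support.measurableSet.compl
  have h1 := hμ t _ hm
  rw [show μ (μ.support)ᶜ = 0 from Measure.support_mem_ae] at h1
  have hmeas : Measurable fun z => T.transition t z (μ.support)ᶜ := by
    have h := measurable_measure_prodMk_left (ν := P) ((measurable_timeMap_uncurry T t) hm)
    have heq : (fun z => T.transition t z (μ.support)ᶜ) = fun z =>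
        P (Prod.mk z ⁻¹' ((fun p : Z × Ω => T.timeMap t p.2 p.1) ⁻¹' (μ.support)ᶜ)) := by
      funext z
      rw [ContinuousRDS.transition, Measure.map_apply (measurable_timeMap T t z) hm]
      rfl
    rw [heq]
    exact h
  rw [lintegral_eq_zero_iff hmeas] at h1
  have h2 : ∀ᵐ z ∂μ, ∀ᵐ ω ∂P, T.timeMap t ω z ∈ μ.support := by
    filter_upwards [h1] with z hz
    rw [ContinuousRDS.transition, Pi.zero_apply, Measure.map_apply (measurable_timeMap T t z) hm] at hz
    exact hz
  refine (Measure.ae_ae_comm (p := fun z ω => T.timeMap t ω z ∈ μ.support) ?_).1 h2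
  exact (measurable_timeMap_uncurry T t) Measure.isClosed_support.measurableSet

/-- For almost every `ω` the invariance relation holds for `μ`-almost every `z`, hence on a set
whose closure contains the support. Both sides are continuous on the support, so the relation
extends to each of its points. -/
theorem ae_pair_mem_preservers (hμ : T.Stationary μ) (A : LinearCocycle T d)
    (hA : A.IsSpecialLinear) {ν : Z → ProbabilityMeasure (Proj d)}
    (hν : ContinuousOn ν μ.support) (hinv : A.InvariantFamily hA μ ν) (t : ℝ≥0) :
    ∀ᵐ ω ∂P, A.pair t ω ∈ preservers μ.support ν := by
  have hX : IsClosed μ.support := Measure.isClosed_support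
  filter_upwards [ae_timeMap_mem_support hμ t, Measure.ae_ae_of_ae_prod (hinv t)] with ω h1 h2
  set s : Set Z := {z | z ∈ μ.support ∧ T.timeMap t ω z ∈ μ.support ∧
    push ⟨A.timeMap t ω z, hA t ω z⟩ (ν z) = ν (T.timeMap t ω z)} with hs
  have hae : ∀ᵐ z ∂μ, z ∈ s := by
    have h0 : ∀ᵐ z ∂μ, z ∈ μ.support := Measure.support_mem_ae
    filter_upwards [h0, h1, h2] with z hz0 hz1 hz2
    exact ⟨hz0, hz1, Subtype.ext hz2⟩
  intro z hz
  have hzs := mem_closure_of_ae hae hz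
  have hne := mem_closure_iff_nhdsWithin_neBot.1 hzs
  have hsX : s ⊆ μ.support := fun y hy => hy.1
  have hself : ∀ᶠ y in 𝓝[s] z, y ∈ s := self_mem_nhdsWithin
  have hT : Tendsto (fun y => T.timeMap t ω y) (𝓝[s] z) (𝓝 (T.timeMap t ω z)) :=
    ((T.timeMap t ω).continuous_toFun.tendsto z).mono_left nhdsWithin_le_nhds
  have h3 : T.timeMap t ω z ∈ μ.support := hX.mem_of_tendsto hT (hself.mono fun y hy => hy.2.1)
  refine ⟨h3, hA t ω z, ?_⟩
  let q : Z → SL d := fun y => ⟨A.timeMap t ω y, hA t ω y⟩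
  have hq : Continuous q := (A.timeMap t ω).continuous_toFun.subtype_mk _
  have h4 : Tendsto (fun y => push (q y) (ν y)) (𝓝[s] z) (𝓝 (push (q z) (ν z))) :=
    (continuous_push.tendsto (q z, ν z)).comp
      (((hq.tendsto z).mono_left nhdsWithin_le_nhds).prodMk_nhds
        ((hν z hz).tendsto.mono_left (nhdsWithin_mono z hsX)))
  have h5 : Tendsto (fun y => ν (T.timeMap t ω y)) (𝓝[s] z) (𝓝 (ν (T.timeMap t ω z))) :=
    (hν _ h3).tendsto.comp (tendsto_nhdsWithin_iff.2 ⟨hT, hself.mono fun y hy => hy.2.1⟩)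
  exact tendsto_nhds_unique h4 (h5.congr' (hself.mono fun y hy => hy.2.2.symm))

theorem totalSupport_subset_preservers (hμ : T.Stationary μ) (A : LinearCocycle T d)
    (hA : A.IsSpecialLinear) {ν : Z → ProbabilityMeasure (Proj d)}
    (hν : ContinuousOn ν μ.support) (hinv : A.InvariantFamily hA μ ν) :
    A.totalSupport ⊆ preservers μ.support ν := by
  have hcl := isClosed_preservers Measure.isClosed_support hν
  refine closure_minimal (iUnion_subset fun t c hc => ?_) hcl
  rw [← hcl.closure_eq, mem_closure_iff_nhds]
  intro U hU
  by_contra h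
  refine (hc U hU).ne' (measure_mono_null (fun ω hω hω' => h ⟨_, hω, hω'⟩)
    (ae_pair_mem_preservers hμ A hA hν hinv t))

/-- A closed subset of the support that is invariant in both directions is empty or everything. -/
theorem eq_support_of_invariant (hSF : T.StrongFeller) (hμ : T.ErgodicStationary μ)
    (A : LinearCocycle T d) (hA : A.IsSpecialLinear) {ν : Z → ProbabilityMeasure (Proj d)}
    (hν : ContinuousOn ν μ.support) (hinv : A.InvariantFamily hA μ ν) {B : Set Z}
    (hB : IsClosed B) (hBX : B ⊆ μ.support) (hBne : B.Nonempty)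
    (hBinv : ∀ c ∈ preservers μ.support ν, ∀ z ∈ μ.support, c.1 z ∈ B ↔ z ∈ B) :
    B = μ.support := by
  have hBm : MeasurableSet B := hB.measurableSet
  set h : Z → ℝ := B.indicator 1 with hh
  have hm : Measurable h := measurable_one.indicator hBm
  have hb : ∃ C, ∀ z, |h z| ≤ C := by
    refine ⟨1, fun z => ?_⟩
    by_cases hz : z ∈ B <;> simp [hh, hz]
  -- The identity holds at every point of the support, not just almost everywhere; this is where
  -- pointwise preservation is used.
  have hP : ∀ t : ℝ≥0, ∀ z ∈ μ.support, T.semigroup t h z = h z := by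
    intro t z hz
    rw [ContinuousRDS.semigroup, ContinuousRDS.transition,
      integral_map (measurable_timeMap T t z).aemeasurable hm.aestronglyMeasurable]
    have : ∀ᵐ ω ∂P, h (T.timeMap t ω z) = h z := by
      filter_upwards [ae_pair_mem_preservers hμ.1 A hA hν hinv t] with ω hω
      have h1 : T.timeMap t ω z ∈ B ↔ z ∈ B := hBinv _ hω z hz
      by_cases hz : z ∈ B
      · simp [hh, hz, h1.2 hz]
      · simp [hh, hz, mt h1.1 hz]
    rw [integral_congr_ae this]
    simp
  have hX : ∀ᵐ z ∂μ, z ∈ μ.support := Measure.support_mem_ae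
  obtain ⟨c, hc⟩ := hμ.2 h hm hb fun t => hX.mono fun z hz => hP t z hz
  -- On the support the indicator agrees with its image under the time-one operator, which is
  -- continuous; almost sure constancy then becomes constancy.
  have hcont : Continuous (T.semigroup 1 h) := (hSF h hm hb 1 one_pos).1
  have hconst : ∀ z ∈ μ.support, h z = c := by
    intro z hz
    rw [← hP 1 z hz]
    have hae : ∀ᵐ y ∂μ, y ∈ {y | T.semigroup 1 h y = c} := by
      filter_upwards [hX, hc] with y hy1 hy2
      exact (hP 1 y hy1).trans hy2
    have h1 := mem_closure_of_ae hae hz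
    rwa [(isClosed_eq hcont continuous_const).closure_eq] at h1
  obtain ⟨b, hbB⟩ := hBne
  have hc1 : c = 1 := by
    rw [← hconst b (hBX hbB)]
    simp [hh, hbB]
  refine Subset.antisymm hBX fun z hz => ?_
  by_contra hzB
  have := hconst z hz
  simp [hh, hzB, hc1] at this

end Cocycle

/-! ### Continuous and measurable labellings of unordered families -/

/-- Sequential convergence up to subsequence and relabelling is turned into a uniform statement by
contradiction. -/
theorem exists_perm_dist_lt {Z M : Type*} [MetricSpace Z] [MetricSpace M] {p : ℕ} {X : Set Z}
    {Q : Z → Fin p → M} {z : Z}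
    (hseq : ∀ y : ℕ → Z, (∀ n, y n ∈ X) → Tendsto y atTop (𝓝 z) →
      ∃ (φ : ℕ → ℕ) (ρ : Equiv.Perm (Fin p)),
        Tendsto (fun n => Q (y (φ n))) atTop (𝓝 (Q z ∘ ρ))) {ε : ℝ} (hε : 0 < ε) :
    ∃ r > 0, ∀ y ∈ X, dist y z < r → ∃ τ : Equiv.Perm (Fin p), ∀ i,
      dist (Q y (τ i)) (Q z i) < ε := by
  by_contra! h
  choose! y hyX hyz hy using fun n : ℕ => h (1 / ((n : ℝ) + 1)) (by positivity)
  have hlim : Tendsto y atTop (𝓝 z) := by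
    rw [tendsto_iff_dist_tendsto_zero]
    exact squeeze_zero (fun _ => dist_nonneg) (fun n => (hyz n).le)
      tendsto_one_div_add_atTop_nhds_zero_nat
  obtain ⟨φ, ρ, hφ⟩ := hseq y hyX hlim
  obtain ⟨n, hn⟩ := ((Metric.tendsto_nhds.1 hφ) ε hε).exists
  obtain ⟨i, hi⟩ := hy (φ n) ρ.symm
  have h1 := (dist_pi_lt_iff hε).1 hn (ρ.symm i)
  rw [Function.comp_apply, Equiv.apply_symm_apply] at h1
  exact absurd h1 (not_lt.2 hi)

/-- Near `z` each member is labelled by the one at `z` that it is close to. The members at `z` are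
separated, so the matching between two nearby points must respect these labels. -/
theorem exists_local_labelling {Z M : Type*} [MetricSpace Z] [MetricSpace M] {p : ℕ} {X : Set Z}
    {Q : Z → Fin p → M} (hinj : ∀ z ∈ X, Function.Injective (Q z))
    (hQ : ∀ z ∈ X, ∀ ε > 0, ∃ r > 0, ∀ y ∈ X, dist y z < r → ∃ τ : Equiv.Perm (Fin p), ∀ i,
      dist (Q y (τ i)) (Q z i) < ε) {z : Z} (hz : z ∈ X) :
    ∃ U : Set Z, IsOpen U ∧ z ∈ U ∧ ∃ τ : Z → Equiv.Perm (Fin p), ∀ i,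
      ContinuousOn (fun y => Q y (τ y i)) (U ∩ X) := by
  obtain ⟨ε₀, hε₀, hsep⟩ : ∃ ε₀ > 0, ∀ i j, i ≠ j → 3 * ε₀ ≤ dist (Q z i) (Q z j) := by
    have h1 : ∀ᶠ ε : ℝ in 𝓝[>] 0, ∀ i j, i ≠ j → 3 * ε ≤ dist (Q z i) (Q z j) := by
      refine eventually_all.2 fun i => eventually_all.2 fun j => ?_
      by_cases hij : i = j
      · exact Eventually.of_forall fun _ h => absurd hij h
      have hpos : 0 < dist (Q z i) (Q z j) := dist_pos.2 fun h => hij (hinj z hz h)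
      filter_upwards [Ioo_mem_nhdsGT (show (0 : ℝ) < dist (Q z i) (Q z j) / 3 by positivity)]
        with ε hε _
      linarith [hε.2]
    obtain ⟨ε, h2, h3⟩ := (h1.and self_mem_nhdsWithin).exists
    exact ⟨ε, h3, h2⟩
  obtain ⟨r, hr, hτ⟩ := hQ z hz ε₀ hε₀
  have : ∀ y, ∃ τ : Equiv.Perm (Fin p), y ∈ X → dist y z < r →
      ∀ i, dist (Q y (τ i)) (Q z i) < ε₀ := by
    intro y
    by_cases hy : y ∈ X ∧ dist y z < r
    · obtain ⟨τ, h⟩ := hτ y hy.1 hy.2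
      exact ⟨τ, fun _ _ => h⟩
    · exact ⟨1, fun h1 h2 => absurd ⟨h1, h2⟩ hy⟩
  choose τ hτ using this
  refine ⟨Metric.ball z r, Metric.isOpen_ball, Metric.mem_ball_self hr, τ, fun i => ?_⟩
  rintro y₀ ⟨hy₀r, hy₀⟩
  rw [ContinuousWithinAt, Metric.tendsto_nhdsWithin_nhds]
  intro ε hε
  obtain ⟨s, hs, hs'⟩ := hQ y₀ hy₀ (min ε ε₀) (lt_min hε hε₀)
  refine ⟨s, hs, ?_⟩
  rintro y ⟨hyr, hy⟩ hys
  obtain ⟨κ, hκ⟩ := hs' y hy hys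
  obtain ⟨j, hj⟩ := κ.surjective (τ y i)
  obtain ⟨k, rfl⟩ := (τ y₀).surjective j
  have h1 := hκ (τ y₀ k)
  rw [hj] at h1
  have h2 := hτ y hy hyr i
  have h3 := hτ y₀ hy₀ hy₀r k
  -- Three errors below `ε₀` cannot bridge the separation `3 * ε₀`.
  have hik : i = k := by
    by_contra hne
    have h4 := hsep i k hne
    have h5 := dist_triangle4 (Q z i) (Q y (τ y i)) (Q y₀ (τ y₀ k)) (Q z k)
    rw [dist_comm (Q z i) (Q y (τ y i))] at h5
    have h6 := min_le_right ε ε₀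
    linarith
  rw [hik] at h1 ⊢
  exact h1.trans_le (min_le_left _ _)

/-- Countably many of the open sets cover `X`; each point takes the labelling of the first one that
contains it. -/
theorem exists_measurable_labelling {Z M : Type*} [TopologicalSpace Z] [SecondCountableTopology Z]
    [MeasurableSpace Z] [BorelSpace Z] [TopologicalSpace M] [MeasurableSpace M] [BorelSpace M]
    {p : ℕ} {X : Set Z} {Q : Z → Fin p → M}
    (h : ∀ z ∈ X, ∃ U : Set Z, IsOpen U ∧ z ∈ U ∧ ∃ τ : Z → Equiv.Perm (Fin p), ∀ i,
      ContinuousOn (fun y => Q y (τ y i)) (U ∩ X)) :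
    ∃ σ : Z → Equiv.Perm (Fin p), ∀ i, Measurable fun z : X => Q z (σ z i) := by
  rcases X.eq_empty_or_nonempty with rfl | ⟨z₀, hz₀⟩
  · exact ⟨fun _ => 1, fun i => measurable_of_empty _⟩
  have hX : ∀ z : X, _ := fun z => h z.1 z.2
  choose U hU hzU τ hτ using hX
  obtain ⟨S, hS, hcov⟩ : ∃ S : Set X, S.Countable ∧ ⋃ z ∈ S, U z = ⋃ z, U z :=
    TopologicalSpace.isOpen_iUnion_countable U hU
  have hSne : S.Nonempty := by
    have : z₀ ∈ ⋃ z ∈ S, U z := by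
      rw [hcov]
      exact mem_iUnion.2 ⟨⟨z₀, hz₀⟩, hzU _⟩
    obtain ⟨s, hs, -⟩ := mem_iUnion₂.1 this
    exact ⟨s, hs⟩
  obtain ⟨e, rfl⟩ := hS.exists_eq_range hSne
  have hex : ∀ z : X, ∃ n, z.1 ∈ U (e n) := by
    intro z
    have : z.1 ∈ ⋃ y ∈ range e, U y := by
      rw [hcov]
      exact mem_iUnion.2 ⟨z, hzU z⟩
    simpa using this
  classical
  let σ : Z → Equiv.Perm (Fin p) := fun y =>
    if hy : y ∈ X then τ (e (Nat.find (hex ⟨y, hy⟩))) y else 1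
  refine ⟨σ, fun i => ?_⟩
  have hUm : ∀ n, MeasurableSet {z : X | z.1 ∈ U (e n)} := fun n =>
    ((hU (e n)).preimage continuous_subtype_val).measurableSet
  have hfind : Measurable fun z : X => Nat.find (hex z) := measurable_find hex hUm
  refine measurable_of_isOpen fun V hV => ?_
  have hpre : (fun z : X => Q z (σ z i)) ⁻¹' V = ⋃ n, {z : X | Nat.find (hex z) = n} ∩
      ({z : X | z.1 ∈ U (e n)} ∩ (fun z : X => Q z (τ (e n) z i)) ⁻¹' V) := by
    ext z
    have hσ : σ z = τ (e (Nat.find (hex z))) z := dif_pos z.2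
    simp only [mem_preimage, mem_iUnion, mem_inter_iff, hσ]
    constructor
    · exact fun hz => ⟨_, rfl, Nat.find_spec (hex z), hz⟩
    · rintro ⟨n, rfl, -, hz⟩
      exact hz
  rw [hpre]
  refine MeasurableSet.iUnion fun n => MeasurableSet.inter
    (hfind (measurableSet_singleton n)) (IsOpen.measurableSet ?_)
  have hc : ContinuousOn (fun z : X => Q z (τ (e n) z i)) {z : X | z.1 ∈ U (e n)} :=
    (hτ (e n) i).comp continuous_subtype_val.continuousOn fun z hz => ⟨hz, z.2⟩
  exact hc.isOpen_inter_preimage ((hU (e n)).preimage continuous_subtype_val) hV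

/-! ### Minimal families carrying a measure -/

/-- `δ` is a minimal list of dimensions for the measure `m`: no finite family of proper subspaces
whose dimensions precede `δ` in the Dershowitz–Manna order carries `m`. -/
def IsMinimalType {d p : ℕ} (m : ProbabilityMeasure (Proj d)) (δ : Fin p → ℕ) : Prop :=
  (∀ i, δ i < d) ∧ ∀ S : Multiset (Submodule ℝ (Vec d)),
    (∀ V ∈ S, Module.finrank ℝ V < d) →
    (∀ᵐ x ∂(m : Measure (Proj d)), ∃ V ∈ S, x.submodule ≤ V) →
    ¬ (S.map fun V : Submodule ℝ (Vec d) => Module.finrank ℝ V).IsDershowitzMannaLT (Finset.univ.val.map δ)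

section Minimal

variable {d p : ℕ} {m : ProbabilityMeasure (Proj d)} {δ : Fin p → ℕ}
  {E E' : Fin p → Submodule ℝ (Vec d)}

/-- Deleting a member removes an entry from the list of dimensions, which is a step down in the
order. -/
theorem IsMinimalType.not_carried_without (hδ : IsMinimalType m δ)
    (hE : ∀ i, Module.finrank ℝ (E i) = δ i) (i : Fin p) :
    ¬ ∀ᵐ x ∂(m : Measure (Proj d)), ∃ k, k ≠ i ∧ x.submodule ≤ E k := by
  intro h
  refine hδ.2 ((Finset.univ.erase i).val.map E) ?_ ?_ ?_
  · intro V hV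
    obtain ⟨k, -, rfl⟩ := Multiset.mem_map.1 hV
    rw [hE]
    exact hδ.1 k
  · filter_upwards [h] with x ⟨k, hk, hx⟩
    exact ⟨E k, Multiset.mem_map_of_mem E (Finset.mem_def.1 (Finset.mem_erase.2 ⟨hk, Finset.mem_univ k⟩)), hx⟩
  · refine ⟨(Finset.univ.erase i).val.map δ, 0, {δ i}, by simp, ?_, ?_, by simp⟩
    · rw [Multiset.map_map, add_zero]
      exact Multiset.map_congr rfl fun k _ => hE k
    · have h1 := Multiset.cons_erase (show i ∈ (Finset.univ : Finset (Fin p)).val by simp)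
      rw [Finset.erase_val, ← Multiset.map_singleton δ, ← Multiset.map_add]
      congr 1
      rw [add_comm, Multiset.singleton_add]
      exact h1.symm

theorem IsMinimalType.injective (hδ : IsMinimalType m δ)
    (hE : ∀ i, Module.finrank ℝ (E i) = δ i) (hc : CarriedBy m E) : Function.Injective E := by
  intro i j hij
  by_contra hne
  refine hδ.not_carried_without hE i ?_
  filter_upwards [hc] with x ⟨k, hk⟩
  by_cases hki : k = i
  · exact ⟨j, Ne.symm hne, by rwa [← hij, ← hki]⟩
  · exact ⟨k, hki, hk⟩

theorem IsMinimalType.ne_bot (hδ : IsMinimalType m δ)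
    (hE : ∀ i, Module.finrank ℝ (E i) = δ i) (hc : CarriedBy m E) (i : Fin p) : E i ≠ ⊥ := by
  intro hi
  refine hδ.not_carried_without hE i ?_
  filter_upwards [hc] with x ⟨k, hk⟩
  refine ⟨k, ?_, hk⟩
  rintro rfl
  rw [hi, le_bot_iff] at hk
  have h1 := x.finrank_submodule
  rw [hk] at h1
  simp at h1

/-- Almost every line lies in a member of each family, so it lies in a common member or in an
intersection of two unshared ones. If the families differed, the common members and these
intersections would carry `m` with a smaller list of dimensions. -/
theorem IsMinimalType.mem_range (hδ : IsMinimalType m δ)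
    (hE : ∀ i, Module.finrank ℝ (E i) = δ i) (hc : CarriedBy m E)
    (hE' : ∀ i, Module.finrank ℝ (E' i) = δ i) (hc' : CarriedBy m E') (i : Fin p) :
    E i ∈ range E' := by
  classical
  by_contra hi
  let dim : Submodule ℝ (Vec d) → ℕ := fun V => Module.finrank ℝ V
  have key : ∀ F : Fin p → Submodule ℝ (Vec d), (∀ i, Module.finrank ℝ (F i) = δ i) →
      CarriedBy m F → (Finset.univ.image F).val.map dim = Finset.univ.val.map δ := by
    intro F hF hcF
    rw [Finset.image_val_of_injOn (hδ.injective hF hcF).injOn, Multiset.map_map]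
    exact Multiset.map_congr rfl fun k _ => hF k
  set S : Finset (Submodule ℝ (Vec d)) := Finset.univ.image E with hS
  set S' : Finset (Submodule ℝ (Vec d)) := Finset.univ.image E' with hS'
  have hsum : (S \ S').val.map dim + (S ∩ S').val.map dim = Finset.univ.val.map δ := by
    rw [← key E hE hc, ← Multiset.map_add, Finset.sdiff_val, Finset.inter_val,
      Multiset.sub_add_inter]
  have hsum' : (S' \ S).val.map dim + (S ∩ S').val.map dim = Finset.univ.val.map δ := by
    rw [← key E' hE' hc', ← Multiset.map_add, Finset.inter_comm, Finset.sdiff_val, Finset.inter_val,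
      Multiset.sub_add_inter]
  -- Cancelling the common members shows that the unshared parts have the same dimensions, so an
  -- unshared member of either family can serve as dominating entry.
  have hdim : (S' \ S).val.map dim = (S \ S').val.map dim :=
    add_right_cancel (hsum'.trans hsum.symm)
  have hlt : ∀ V ∈ S, dim V < d := by
    intro V hV
    obtain ⟨k, -, rfl⟩ := Finset.mem_image.1 hV
    exact (hE k).trans_lt (hδ.1 k)
  let W : Multiset (Submodule ℝ (Vec d)) :=
    ((S \ S') ×ˢ (S' \ S)).val.map fun q => q.1 ⊓ q.2
  have hW : ∀ V ∈ W, ∃ V₁ ∈ S \ S', ∃ V₂ ∈ S' \ S, V = V₁ ⊓ V₂ := by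
    intro V hV
    obtain ⟨q, hq, rfl⟩ := Multiset.mem_map.1 hV
    have hq' := Finset.mem_product.1 (Finset.mem_def.2 hq)
    exact ⟨q.1, hq'.1, q.2, hq'.2, rfl⟩
  refine hδ.2 ((S ∩ S').val + W) ?_ ?_ ?_
  · intro V hV
    rcases Multiset.mem_add.1 hV with hV | hV
    · exact hlt V (Finset.mem_inter.1 (Finset.mem_def.2 hV)).1
    · obtain ⟨V₁, h₁, V₂, -, rfl⟩ := hW V hV
      exact (Submodule.finrank_mono inf_le_left).trans_lt (hlt V₁ (Finset.mem_sdiff.1 h₁).1)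
  · filter_upwards [hc, hc'] with x ⟨k, hk⟩ ⟨k', hk'⟩
    have h1 : E k ∈ S := Finset.mem_image_of_mem _ (Finset.mem_univ _)
    have h2 : E' k' ∈ S' := Finset.mem_image_of_mem _ (Finset.mem_univ _)
    by_cases h3 : E k ∈ S'
    · exact ⟨E k, Multiset.mem_add.2 (Or.inl (Finset.mem_def.1 (Finset.mem_inter.2 ⟨h1, h3⟩))), hk⟩
    by_cases h4 : E' k' ∈ S
    · exact ⟨E' k', Multiset.mem_add.2
        (Or.inl (Finset.mem_def.1 (Finset.mem_inter.2 ⟨h4, h2⟩))), hk'⟩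
    refine ⟨E k ⊓ E' k', Multiset.mem_add.2 (Or.inr ?_), le_inf hk hk'⟩
    exact Multiset.mem_map.2 ⟨(E k, E' k'), Finset.mem_def.1 (Finset.mem_product.2
      ⟨Finset.mem_sdiff.2 ⟨h1, h3⟩, Finset.mem_sdiff.2 ⟨h2, h4⟩⟩), rfl⟩
  · refine ⟨(S ∩ S').val.map dim, W.map dim, (S \ S').val.map dim, ?_, ?_, ?_, ?_⟩
    · have h1 : E i ∈ S \ S' := by
        refine Finset.mem_sdiff.2 ⟨Finset.mem_image_of_mem _ (Finset.mem_univ _), fun h => hi ?_⟩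
        obtain ⟨k, -, hk⟩ := Finset.mem_image.1 h
        exact ⟨k, hk⟩
      have h2 := Multiset.mem_map_of_mem dim (Finset.mem_def.1 h1)
      intro h0
      rw [h0] at h2
      exact Multiset.notMem_zero _ h2
    · exact Multiset.map_add _ _ _
    · rw [add_comm]
      exact hsum.symm
    · intro n hn
      obtain ⟨V, hV, rfl⟩ := Multiset.mem_map.1 hn
      obtain ⟨V₁, h₁, V₂, h₂, rfl⟩ := hW V hV
      -- The intersection is strictly smaller than `V₂` if `V₁` lies in it, and strictly smaller
      -- than `V₁` otherwise.
      by_cases hle : V₁ ≤ V₂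
      · refine ⟨dim V₂, ?_, ?_⟩
        · rw [← hdim]
          exact Multiset.mem_map_of_mem dim (Finset.mem_def.1 h₂)
        · refine Submodule.finrank_lt_finrank_of_lt ?_
          rw [inf_eq_left.2 hle]
          refine lt_of_le_of_ne hle ?_
          rintro rfl
          exact (Finset.mem_sdiff.1 h₁).2 (Finset.mem_sdiff.1 h₂).1
      · refine ⟨dim V₁, Multiset.mem_map_of_mem dim (Finset.mem_def.1 h₁), ?_⟩
        refine Submodule.finrank_lt_finrank_of_lt (lt_of_le_of_ne inf_le_left fun h => hle ?_)
        exact inf_eq_left.1 h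

theorem IsMinimalType.exists_perm (hδ : IsMinimalType m δ)
    (hE : ∀ i, Module.finrank ℝ (E i) = δ i) (hc : CarriedBy m E)
    (hE' : ∀ i, Module.finrank ℝ (E' i) = δ i) (hc' : CarriedBy m E') :
    ∃ ρ : Equiv.Perm (Fin p), ∀ i, E i = E' (ρ i) := by
  choose r hr using hδ.mem_range hE hc hE' hc'
  have hinj : Function.Injective r := fun i j hij => hδ.injective hE hc (by
    rw [← hr, ← hr, hij])
  exact ⟨Equiv.ofBijective r hinj.bijective_of_finite, fun i => (hr i).symm⟩

theorem CarriedBy.pos (hc : CarriedBy m E) : 1 ≤ p := by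
  by_contra hp
  obtain rfl : p = 0 := by omega
  obtain ⟨x, i, -⟩ := hc.exists
  exact i.elim0

end Minimal

/-- The measure is carried by a family of subspaces with dimensions `δ`. -/
def HasType {d p : ℕ} (m : ProbabilityMeasure (Proj d)) (δ : Fin p → ℕ) : Prop :=
  ∃ E : Fin p → Submodule ℝ (Vec d), (∀ i, Module.finrank ℝ (E i) = δ i) ∧ CarriedBy m E

theorem HasType.push {d p : ℕ} {m : ProbabilityMeasure (Proj d)} {δ : Fin p → ℕ}
    (h : HasType m δ) (g : SL d) : HasType (push g m) δ := by
  obtain ⟨E, hE, hc⟩ := h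
  exact ⟨_, fun i => (finrank_map_SL g (E i)).trans (hE i), hc.push g⟩

theorem hasType_push_iff {d p : ℕ} {m : ProbabilityMeasure (Proj d)} {δ : Fin p → ℕ} (g : SL d) :
    HasType (push g m) δ ↔ HasType m δ := by
  refine ⟨fun h => ?_, fun h => h.push g⟩
  have := h.push g.inv
  rwa [push_inv_push] at this

theorem hasType_of_multiset {d : ℕ} {m : ProbabilityMeasure (Proj d)}
    (S : Multiset (Submodule ℝ (Vec d)))
    (hS : ∀ᵐ x ∂(m : Measure (Proj d)), ∃ V ∈ S, x.submodule ≤ V) :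
    ∃ (p : ℕ) (δ : Fin p → ℕ), HasType m δ ∧
      Finset.univ.val.map δ = S.map fun V : Submodule ℝ (Vec d) => Module.finrank ℝ V := by
  refine ⟨S.toList.length, fun i => Module.finrank ℝ (S.toList.get i), ⟨S.toList.get, fun _ => rfl, ?_⟩, ?_⟩
  · filter_upwards [hS] with x ⟨V, hV, hx⟩
    obtain ⟨i, hi⟩ := List.mem_iff_get.1 (Multiset.mem_toList.2 hV)
    exact ⟨i, by rwa [hi]⟩
  · conv_rhs => rw [← Multiset.coe_toList S]
    rw [Multiset.map_coe, Fin.univ_val_map]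
    congr 1
    conv_rhs => rw [← List.ofFn_get S.toList]
    exact List.ofFn_comp' S.toList.get fun V : Submodule ℝ (Vec d) => Module.finrank ℝ V

/-! ### The degenerate case: invariant subspaces -/

section Cocycle

variable {Ω : Type*} [MeasurableSpace Ω] {P : Measure Ω} [IsProbabilityMeasure P] {θ : Semiflow P}
  {Z : Type*} [MetricSpace Z] [SecondCountableTopology Z] [MeasurableSpace Z] [BorelSpace Z]
  {T : ContinuousRDS θ Z} {μ : Measure Z} [IsProbabilityMeasure μ] {d : ℕ}

/-- Carrying families of fixed dimensions survive limits, by compactness of Grassmannians, and the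
action of `SL d`; rigidity applies. -/
theorem hasType_of_mem_support (hSF : T.StrongFeller) (hμ : T.ErgodicStationary μ)
    (A : LinearCocycle T d) (hA : A.IsSpecialLinear) {ν : Z → ProbabilityMeasure (Proj d)}
    (hν : ContinuousOn ν μ.support) (hinv : A.InvariantFamily hA μ ν) {p : ℕ} {δ : Fin p → ℕ}
    {z₀ : Z} (hz₀ : z₀ ∈ μ.support) (h : HasType (ν z₀) δ) :
    ∀ z ∈ μ.support, HasType (ν z) δ := by
  set B : Set Z := {z | z ∈ μ.support ∧ HasType (ν z) δ} with hB
  have hX : IsClosed μ.support := Measure.isClosed_support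
  have : B = μ.support := by
    refine eq_support_of_invariant hSF hμ A hA hν hinv ?_ (fun z hz => hz.1) ⟨z₀, hz₀, h⟩ ?_
    · refine IsSeqClosed.isClosed fun y z hy hyz => ?_
      have hz : z ∈ μ.support := hX.mem_of_tendsto hyz (Eventually.of_forall fun n => (hy n).1)
      choose E hE hc using fun n => (hy n).2
      have hlim : Tendsto (fun n => ν (y n)) atTop (𝓝 (ν z)) :=
        (hν z hz).tendsto.comp (tendsto_nhdsWithin_iff.2
          ⟨hyz, Eventually.of_forall fun n => (hy n).1⟩)
      obtain ⟨F, φ, -, hF, hcF, -⟩ := exists_subseq_carriedBy hlim E hE hc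
      exact ⟨hz, F, hF, hcF⟩
    · intro c hc z hz
      obtain ⟨h1, h2, h3⟩ := hc z hz
      simp only [hB, mem_ofPred_eq, ← h3, hasType_push_iff, h1, hz]
  intro z hz
  rw [← this] at hz
  exact hz.2

theorem hasInvariantSubspaces_of_degenerate (hSF : T.StrongFeller) (hμ : T.ErgodicStationary μ)
    (A : LinearCocycle T d) (hA : A.IsSpecialLinear) {ν : Z → ProbabilityMeasure (Proj d)}
    (hν : ContinuousOn ν μ.support) (hinv : A.InvariantFamily hA μ ν)
    {z₀ : Z} (hz₀ : z₀ ∈ μ.support) (h : Degenerate (ν z₀)) :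
    HasInvariantSubspaces A.totalSupport μ.support ν := by
  let Λ : Set (Σ p : ℕ, Fin p → ℕ) := {δ | (∀ i, δ.2 i < d) ∧ HasType (ν z₀) δ.2}
  let dm : (Σ p : ℕ, Fin p → ℕ) → Multiset ℕ := fun δ => Finset.univ.val.map δ.2
  have hΛ : Λ.Nonempty := by
    obtain ⟨p, E, hE, hc⟩ := h
    exact ⟨⟨p, fun i => Module.finrank ℝ (E i)⟩, hE, E, fun _ => rfl, hc⟩
  obtain ⟨⟨p, δ⟩, ⟨hδd, hδ⟩, hmin⟩ := (InvImage.wf dm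
    (Multiset.wellFounded_isDershowitzMannaLT (α := ℕ))).has_min Λ hΛ
  have hall := hasType_of_mem_support hSF hμ A hA hν hinv hz₀ hδ
  -- A smaller list of dimensions at `z` would spread back to `z₀`, against the choice of `δ`.
  have hminz : ∀ z ∈ μ.support, IsMinimalType (ν z) δ := by
    refine fun z hz => ⟨hδd, fun S hS hc hlt => ?_⟩
    obtain ⟨p', δ', h1, h2⟩ := hasType_of_multiset S hc
    refine hmin ⟨p', δ'⟩ ⟨fun i => ?_, hasType_of_mem_support hSF hμ A hA hν hinv hz h1 z₀ hz₀⟩ ?_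
    · have h3 : δ' i ∈ Finset.univ.val.map δ' := Multiset.mem_map_of_mem δ' (Finset.mem_univ i)
      rw [h2] at h3
      obtain ⟨V, hV, hVi⟩ := Multiset.mem_map.1 h3
      exact hVi.symm.trans_lt (hS V hV)
    · change Multiset.IsDershowitzMannaLT (Finset.univ.val.map δ') (Finset.univ.val.map δ)
      rwa [h2]
  have : ∀ z, ∃ E : Fin p → Submodule ℝ (Vec d), z ∈ μ.support →
      (∀ i, Module.finrank ℝ (E i) = δ i) ∧ CarriedBy (ν z) E := by
    intro z
    by_cases hz : z ∈ μ.support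
    · obtain ⟨E, hE⟩ := hall z hz
      exact ⟨E, fun _ => hE⟩
    · exact ⟨fun _ => ⊥, fun h => absurd h hz⟩
  choose E hE using this
  have hQinj : ∀ z ∈ μ.support, Function.Injective (proj (E z)) := by
    intro z hz i j hij
    exact (hminz z hz).injective (hE z hz).1 (hE z hz).2 (Submodule.starProjection_inj.1 hij)
  have hloc : ∀ z ∈ μ.support, ∃ U : Set Z, IsOpen U ∧ z ∈ U ∧ ∃ τ : Z → Equiv.Perm (Fin p), ∀ i,
      ContinuousOn (fun y => proj (E y) (τ y i)) (U ∩ μ.support) := by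
    intro z hz
    refine exists_local_labelling (Q := fun y => proj (E y)) hQinj
      (fun z hz ε hε => exists_perm_dist_lt (Q := fun y => proj (E y)) (fun y hy hyz => ?_) hε) hz
    have hlim : Tendsto (fun n => ν (y n)) atTop (𝓝 (ν z)) :=
      (hν z hz).tendsto.comp (tendsto_nhdsWithin_iff.2 ⟨hyz, Eventually.of_forall hy⟩)
    obtain ⟨F, φ, -, hF, hcF, hφ⟩ := exists_subseq_carriedBy hlim (fun n => E (y n))
      (fun n => (hE _ (hy n)).1) (fun n => (hE _ (hy n)).2)
    -- Any limit of the families at `y n` carries `ν z` with the same dimensions, so by uniqueness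
    -- it is `E z` reordered.
    obtain ⟨ρ, hρ⟩ := (hminz z hz).exists_perm hF hcF (hE z hz).1 (hE z hz).2
    refine ⟨φ, ρ, ?_⟩
    have : proj F = proj (E z) ∘ ρ := by
      funext i
      simp only [proj, hρ, Function.comp_apply]
    rwa [← this]
  obtain ⟨σ, hσ⟩ := exists_measurable_labelling hloc
  refine ⟨p, fun i z => E z (σ z i), (hE z₀ hz₀).2.pos, hσ, ?_, ?_, ?_, ?_⟩
  · intro z hz
    obtain ⟨hEd, hEc⟩ := hE z hz
    refine ⟨((hminz z hz).injective hEd hEc).comp (σ z).injective, fun i =>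
      ⟨(hminz z hz).ne_bot hEd hEc _, fun htop => ?_⟩⟩
    have htop : E z (σ z i) = ⊤ := htop
    have h1 := hEd (σ z i)
    rw [htop, finrank_top, finrank_euclideanSpace, Fintype.card_fin] at h1
    exact (hδd _).ne h1.symm
  · intro c hc z hz
    obtain ⟨hTz, hdet, hpush⟩ := totalSupport_subset_preservers hμ.1 A hA hν hinv hc z hz
    have hc' := (hE z hz).2.push ⟨c.2 z, hdet⟩
    rw [hpush] at hc'
    obtain ⟨ρ, hρ⟩ := (hminz _ hTz).exists_perm
      (fun i => (finrank_map_SL ⟨c.2 z, hdet⟩ (E z i)).trans ((hE z hz).1 i)) hc'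
      (hE _ hTz).1 (hE _ hTz).2
    -- The permutation `ρ` refers to the unsorted families `E`; it is rewritten in the measurable
    -- labels at both ends.
    refine ⟨((σ z).trans ρ).trans (σ (c.1 z)).symm, fun i => ?_⟩
    simp only [Equiv.trans_apply, Equiv.apply_symm_apply]
    exact hρ (σ z i)
  · intro z hz
    have h1 : ∀ᵐ x ∂(ν z : Measure (Proj d)), x ∈ {x : Proj d | ∃ i, x.submodule ≤ E z (σ z i)} := by
      filter_upwards [(hE z hz).2] with x ⟨i, hi⟩
      exact ⟨(σ z).symm i, by rwa [Equiv.apply_symm_apply]⟩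
    exact (measure_congr (eventuallyEq_univ.2 h1)).trans measure_univ
  · intro z hz
    obtain ⟨U, hU, hzU, τ, hτ⟩ := hloc z hz
    refine ⟨U, hU, hzU, fun y => (τ y).trans (σ y).symm, fun i => ?_⟩
    simp only [Equiv.trans_apply, Equiv.apply_symm_apply]
    exact hτ i

end Cocycle

/-! ### Bounded groups of operators have fixed points -/

/-- A bounded group of operators on a finite-dimensional space has a fixed point in the closed
convex hull of every orbit. -/
theorem exists_fixedPoint_of_bounded {W : Type*} [NormedAddCommGroup W] [NormedSpace ℝ W]
    [FiniteDimensional ℝ W] {K : Set (W →L[ℝ] W)} (hid : ContinuousLinearMap.id ℝ W ∈ K)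
    (hmul : ∀ k ∈ K, ∀ l ∈ K, k.comp l ∈ K)
    (hinv : ∀ k ∈ K, ∃ l ∈ K, l.comp k = ContinuousLinearMap.id ℝ W) {R : ℝ}
    (hR : ∀ k ∈ K, ‖k‖ ≤ R) (w₀ : W) :
    ∃ w ∈ closure (convexHull ℝ {w | ∃ k ∈ K, w = k w₀}), ∀ k ∈ K, k w = w := by
  have : ProperSpace W := FiniteDimensional.proper ℝ W
  set S : Set W := {w | ∃ k ∈ K, w = k w₀} with hS
  let e := toEuclidean (E := W)
  let ec : W →L[ℝ] EuclideanSpace ℝ (Fin (Module.finrank ℝ W)) := e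
  let es : EuclideanSpace ℝ (Fin (Module.finrank ℝ W)) →L[ℝ] W := e.symm
  have hR0 : 0 ≤ R := (norm_nonneg _).trans (hR _ hid)
  have hKne : Nonempty K := ⟨⟨_, hid⟩⟩
  have hbd : ∀ (k : K) (w : W), ‖ec (k.1 w)‖ ≤ ‖ec‖ * R * ‖w‖ := fun k w =>
    calc ‖ec (k.1 w)‖ ≤ ‖ec‖ * (‖k.1‖ * ‖w‖) :=
          (ec.le_opNorm _).trans (by gcongr; exact k.1.le_opNorm w)
      _ ≤ ‖ec‖ * (R * ‖w‖) := by gcongr; exact hR _ k.2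
      _ = _ := by ring
  -- The supremum over `K` of a Euclidean norm, which `K` cannot increase. Using a Euclidean norm
  -- gives strict convexity through the parallelogram law; a minimizer on the hull will be the fixed
  -- point.
  let F : W → ℝ := fun w => ⨆ k : K, ‖ec (k.1 w)‖
  have hbdd : ∀ w, BddAbove (range fun k : K => ‖ec (k.1 w)‖) := fun w =>
    ⟨‖ec‖ * R * ‖w‖, by rintro _ ⟨k, rfl⟩; exact hbd k w⟩
  have hle : ∀ (k : K) (w : W), ‖ec (k.1 w)‖ ≤ F w := fun k w => le_ciSup (hbdd w) k
  have hFc : Continuous F := by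
    refine (LipschitzWith.of_le_add_mul (Real.toNNReal (‖ec‖ * R)) fun x y => ?_).continuous
    rw [Real.coe_toNNReal _ (by positivity)]
    refine ciSup_le fun k => ?_
    have h1 : ec (k.1 x) = ec (k.1 y) + ec (k.1 (x - y)) := by
      rw [← map_add, ← map_add, add_sub_cancel]
    rw [h1, dist_eq_norm]
    exact (norm_add_le _ _).trans (add_le_add (hle k y) (hbd k _))
  have hSb : Bornology.IsBounded S := by
    refine (Metric.isBounded_closedBall (x := (0 : W)) (r := R * ‖w₀‖)).subset ?_
    rintro _ ⟨k, hk, rfl⟩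
    rw [mem_closedBall_zero_iff]
    exact (k.le_opNorm w₀).trans (by gcongr; exact hR k hk)
  have hcomp : IsCompact (closure (convexHull ℝ S)) :=
    (isBounded_convexHull.2 hSb).isCompact_closure
  have hne : (closure (convexHull ℝ S)).Nonempty :=
    ⟨w₀, subset_closure (subset_convexHull ℝ S ⟨_, hid, rfl⟩)⟩
  obtain ⟨w, hw, hmin⟩ := hcomp.exists_isMinOn hne hFc.continuousOn
  refine ⟨w, hw, fun k hk => ?_⟩
  have hkw : k w ∈ closure (convexHull ℝ S) := by
    refine map_mem_closure k.continuous hw fun x hx => ?_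
    have h1 : (k : W →ₗ[ℝ] W) x ∈ (k : W →ₗ[ℝ] W) '' convexHull ℝ S := ⟨x, hx, rfl⟩
    rw [LinearMap.image_convexHull] at h1
    refine convexHull_mono ?_ h1
    rintro _ ⟨_, ⟨l, hl, rfl⟩, rfl⟩
    exact ⟨k.comp l, hmul k hk l hl, rfl⟩
  by_contra hne'
  set u : W := (1 / 2 : ℝ) • w + (1 / 2 : ℝ) • k w with hu
  have huS : u ∈ closure (convexHull ℝ S) :=
    (convex_convexHull ℝ S).closure hw hkw (by norm_num) (by norm_num) (by norm_num)
  have hsub : 0 < ‖w - k w‖ := norm_pos_iff.2 (sub_ne_zero.2 (Ne.symm hne'))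
  -- Inverses in `K` are also bounded by `R`, so no element can shrink `w - k w` by more than a
  -- fixed factor. The resulting gap `η` is uniform and survives the supremum.
  have hlow : ∀ l : K, ‖w - k w‖ ≤ R * ‖es‖ * ‖ec (l.1 (w - k w))‖ := by
    intro l
    obtain ⟨l', hl', hll⟩ := hinv l.1 l.2
    have h1 : w - k w = l' (es (ec (l.1 (w - k w)))) := by
      have h2 : es (ec (l.1 (w - k w))) = l.1 (w - k w) := e.symm_apply_apply _
      rw [h2]
      exact (DFunLike.congr_fun hll (w - k w)).symm
    calc ‖w - k w‖ = ‖l' (es (ec (l.1 (w - k w))))‖ := by rw [← h1]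
      _ ≤ ‖l'‖ * ‖es (ec (l.1 (w - k w)))‖ := l'.le_opNorm _
      _ ≤ R * (‖es‖ * ‖ec (l.1 (w - k w))‖) := by
          gcongr
          · exact hR _ hl'
          · exact es.le_opNorm _
      _ = _ := by ring
  have hRe : 0 < R * ‖es‖ := by
    refine lt_of_le_of_ne (by positivity) fun h => ?_
    have := hlow ⟨_, hid⟩
    rw [← h, zero_mul] at this
    exact absurd hsub (not_lt.2 this)
  set η : ℝ := ‖w - k w‖ / (R * ‖es‖) with hη
  have hη0 : 0 < η := div_pos hsub hRe
  have hkey : ∀ l : K, ‖ec (l.1 u)‖ ^ 2 ≤ F w ^ 2 - η ^ 2 / 4 := by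
    intro l
    set a := ec (l.1 w) with ha
    set b := ec (l.1 (k w)) with hb
    have h1 : ‖a‖ ≤ F w := hle l w
    have h2 : ‖b‖ ≤ F w := hle ⟨l.1.comp k, hmul _ l.2 _ hk⟩ w
    have h3 : η ≤ ‖a - b‖ := by
      rw [hη, div_le_iff₀ hRe, ha, hb, ← map_sub, ← map_sub, mul_comm]
      exact hlow l
    have h4 : ec (l.1 u) = (1 / 2 : ℝ) • (a + b) := by
      rw [hu, map_add, map_smul, map_smul, map_add, map_smul, map_smul, smul_add]
    have h5 := parallelogram_law_with_norm ℝ a b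
    have h6 : ‖ec (l.1 u)‖ = 1 / 2 * ‖a + b‖ := by
      rw [h4, norm_smul, Real.norm_of_nonneg (by norm_num)]
    rw [h6]
    nlinarith [norm_nonneg a, norm_nonneg b, norm_nonneg (a - b), mul_self_le_mul_self hη0.le h3,
      mul_self_le_mul_self (norm_nonneg a) h1, mul_self_le_mul_self (norm_nonneg b) h2]
  have hFw : 0 ≤ F w := (norm_nonneg _).trans (hle ⟨_, hid⟩ w)
  have hFu : F u ≤ √(F w ^ 2 - η ^ 2 / 4) := ciSup_le fun l => Real.le_sqrt_of_sq_le (hkey l)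
  have h7 := hkey ⟨_, hid⟩
  have hFw' : 0 < F w := by
    refine lt_of_le_of_ne hFw fun h => ?_
    rw [← h] at h7
    nlinarith [sq_nonneg ‖ec ((ContinuousLinearMap.id ℝ W) u)‖]
  have h8 : √(F w ^ 2 - η ^ 2 / 4) < F w := by
    rw [Real.sqrt_lt' hFw']
    nlinarith
  exact absurd (hmin huS) (not_le.2 (hFu.trans_lt h8))

/-! ### Bilinear forms -/

set_option maxSynthPendingDepth 3

/-- Bilinear forms on `ℝ^d`. -/
abbrev Form (d : ℕ) : Type := Vec d →L[ℝ] Vec d →L[ℝ] ℝ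

/-- Pull-back of bilinear forms. -/
noncomputable def pull {d : ℕ} (g : Mat d) : Form d →L[ℝ] Form d :=
  LinearMap.mkContinuous
    { toFun := fun b : Form d => b.bilinearComp g g
      map_add' := fun _ _ => rfl
      map_smul' := fun _ _ => rfl } (‖g‖ * ‖g‖) fun b => by
    refine ContinuousLinearMap.opNorm_le_bound₂ _ (by positivity) fun v w => ?_
    calc ‖b (g v) (g w)‖ ≤ ‖b‖ * ‖g v‖ * ‖g w‖ := b.le_opNorm₂ _ _
      _ ≤ ‖b‖ * (‖g‖ * ‖v‖) * (‖g‖ * ‖w‖) := by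
          gcongr
          · exact g.le_opNorm v
          · exact g.le_opNorm w
      _ = ‖g‖ * ‖g‖ * ‖b‖ * ‖v‖ * ‖w‖ := by ring

@[simp] theorem pull_apply {d : ℕ} (g : Mat d) (b : Form d) (v w : Vec d) :
    pull g b v w = b (g v) (g w) := rfl

theorem norm_pull_le {d : ℕ} (g : Mat d) : ‖pull g‖ ≤ ‖g‖ * ‖g‖ :=
  LinearMap.mkContinuous_norm_le _ (by positivity) _

theorem continuous_pull {d : ℕ} (b : Form d) : Continuous fun g : Mat d => pull g b := by
  refine continuous_clm_apply.2 fun v => continuous_clm_apply.2 fun w => ?_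
  simp only [pull_apply]
  fun_prop

theorem isClosed_setOf_form_ge {d : ℕ} (c : ℝ) :
    IsClosed {b : Form d | (∀ v w, b v w = b w v) ∧ ∀ v, c * ‖v‖ ^ 2 ≤ b v v} := by
  have h : ∀ v w : Vec d, Continuous fun b : Form d => b v w := fun v w => by fun_prop
  simp only [ofPred_and, ofPred_forall]
  refine IsClosed.inter (isClosed_iInter fun v => isClosed_iInter fun w =>
    isClosed_eq (h v w) (h w v)) (isClosed_iInter fun v => isClosed_le continuous_const (h v v))

/-- A uniform lower bound survives both averaging and limits, unlike bare positive definiteness,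
which a limit may lose. -/
theorem convex_setOf_form_ge {d : ℕ} (c : ℝ) :
    Convex ℝ {b : Form d | (∀ v w, b v w = b w v) ∧ ∀ v, c * ‖v‖ ^ 2 ≤ b v v} := by
  intro b hb b' hb' s t hs ht hst
  refine ⟨fun v w => ?_, fun v => ?_⟩
  · change s * b v w + t * b' v w = s * b w v + t * b' w v
    rw [hb.1, hb'.1]
  · change _ ≤ s * b v v + t * b' v v
    have h1 := mul_le_mul_of_nonneg_left (hb.2 v) hs
    have h2 := mul_le_mul_of_nonneg_left (hb'.2 v) ht
    calc c * ‖v‖ ^ 2 = s * (c * ‖v‖ ^ 2) + t * (c * ‖v‖ ^ 2) := by rw [← add_mul, hst, one_mul]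
      _ ≤ _ := add_le_add h1 h2

/-! ### Inner products attached to nondegenerate measures -/

/-- An unbounded sequence in the stabilizer gives a constant, hence convergent, sequence of images,
contradicting Furstenberg's lemma. -/
theorem exists_bound_stabilizer {d : ℕ} {m : ProbabilityMeasure (Proj d)} (hm : ¬ Degenerate m) :
    ∃ R : ℝ, ∀ k : SL d, push k m = m → ‖k.1‖ ≤ R := by
  by_contra! h
  choose k hk hkn using fun n : ℕ => h n
  have h1 : Tendsto (fun n => push (k n) m) atTop (𝓝 m) := by
    simp only [hk]
    exact tendsto_const_nhds
  obtain ⟨q, φ, hφ, hq⟩ := exists_subseq_tendsto_of_push h1 hm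
  have h2 : Tendsto (fun n => ‖(k (φ n)).1‖) atTop (𝓝 ‖q.1‖) :=
    ((continuous_subtype_val.norm).tendsto q).comp hq
  refine not_tendsto_atTop_of_tendsto_nhds h2 ?_
  exact tendsto_atTop_mono (fun n => (hkn (φ n)).le)
    (tendsto_natCast_atTop_atTop.comp hφ.tendsto_atTop)

theorem det_comp_SL {d : ℕ} (g h : SL d) : (g.1.comp h.1).det = 1 := by
  rw [det_comp, g.2, h.2, one_mul]

/-- The identity of `SL_d`. -/
noncomputable def SL.one (d : ℕ) : SL d := ⟨ContinuousLinearMap.id ℝ (Vec d), LinearMap.det_id⟩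

theorem push_one {d : ℕ} (m : ProbabilityMeasure (Proj d)) : push (SL.one d) m = m := by
  have h := push_inv_push (SL.one d) m
  rw [← push_comp _ _ (det_comp_SL _ _)] at h
  convert h using 2
  exact Subtype.ext (SL.inv_comp (SL.one d)).symm

theorem push_inv_eq {d : ℕ} {g : SL d} {m m' : ProbabilityMeasure (Proj d)} (h : push g m = m') :
    push g.inv m' = m := by
  rw [← h, push_inv_push]

/-- The stabilizer acts on forms as a bounded group, so the closed convex hull of the orbit of the
Euclidean inner product contains a fixed form. -/
theorem exists_invariant_innerProduct {d : ℕ} {m : ProbabilityMeasure (Proj d)}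
    (hm : ¬ Degenerate m) :
    ∃ b : Form d, IsInnerProduct b ∧ ∀ k : SL d, push k m = m → pull k.1 b = b := by
  obtain ⟨R, hR⟩ := exists_bound_stabilizer hm
  have hR0 : 0 ≤ R := (norm_nonneg _).trans (hR _ (push_one m))
  let K : Set (Form d →L[ℝ] Form d) := {q | ∃ k : SL d, push k m = m ∧ q = pull k.1}
  let b₀ : Form d := innerSL ℝ
  have hid : ContinuousLinearMap.id ℝ (Form d) ∈ K := ⟨SL.one d, push_one m, rfl⟩
  have hmul : ∀ q ∈ K, ∀ l ∈ K, q.comp l ∈ K := by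
    rintro _ ⟨k, hk, rfl⟩ _ ⟨l, hl, rfl⟩
    exact ⟨⟨l.1.comp k.1, det_comp_SL l k⟩, by rw [push_comp, hk, hl], rfl⟩
  have hinv : ∀ q ∈ K, ∃ l ∈ K, l.comp q = ContinuousLinearMap.id ℝ (Form d) := by
    rintro _ ⟨k, hk, rfl⟩
    refine ⟨_, ⟨k.inv, push_inv_eq hk, rfl⟩, ?_⟩
    ext b v w
    have h1 : ∀ v, k.1 (k.inv.1 v) = v := DFunLike.congr_fun k.comp_inv
    simp [h1]
  obtain ⟨b, hb, hfix⟩ := exists_fixedPoint_of_bounded hid hmul hinv (R := R * R) (by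
    rintro _ ⟨k, hk, rfl⟩
    refine (norm_pull_le k.1).trans ?_
    gcongr <;> exact hR k hk) b₀
  -- From `‖v‖ = ‖k⁻¹ k v‖ ≤ R ‖k v‖`; adding one to `R` keeps the constant positive.
  set c : ℝ := ((R + 1) ^ 2)⁻¹ with hc
  have hc0 : 0 < c := by positivity
  have hmem : b ∈ {b : Form d | (∀ v w, b v w = b w v) ∧ ∀ v, c * ‖v‖ ^ 2 ≤ b v v} := by
    refine closure_minimal (convexHull_min ?_ (convex_setOf_form_ge c)) (isClosed_setOf_form_ge c) hb
    rintro _ ⟨_, ⟨k, hk, rfl⟩, rfl⟩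
    have h0 : ∀ v w, pull k.1 b₀ v w = inner ℝ (k.1 v) (k.1 w) := fun v w => rfl
    refine ⟨fun v w => by rw [h0, h0, real_inner_comm], fun v => ?_⟩
    rw [h0, real_inner_self_eq_norm_sq, hc, inv_mul_le_iff₀ (by positivity), ← mul_pow]
    gcongr
    have h1 : k.inv.1 (k.1 v) = v := DFunLike.congr_fun k.inv_comp v
    calc ‖v‖ = ‖k.inv.1 (k.1 v)‖ := by rw [h1]
      _ ≤ ‖k.inv.1‖ * ‖k.1 v‖ := k.inv.1.le_opNorm _
      _ ≤ (R + 1) * ‖k.1 v‖ := by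
          gcongr
          exact (hR _ (push_inv_eq hk)).trans (by linarith)
  refine ⟨b, ⟨hmem.1, fun v hv => ?_⟩, fun k hk => hfix _ ⟨k, hk, rfl⟩⟩
  have := norm_pos_iff.2 hv
  exact lt_of_lt_of_le (by positivity) (hmem.2 v)

/-- Two matrices carrying `m` to the same measure differ by an element of the stabilizer, which
fixes `b`. The transported form depends only on the image measure. -/
theorem pull_inv_eq_of_push_eq {d : ℕ} {m : ProbabilityMeasure (Proj d)} {b : Form d}
    (hb : ∀ k : SL d, push k m = m → pull k.1 b = b) {g h : SL d} (hgh : push g m = push h m) :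
    pull g.inv.1 b = pull h.inv.1 b := by
  have h1 : push ⟨h.inv.1.comp g.1, det_comp_SL _ _⟩ m = m := by
    rw [push_comp, hgh, push_inv_push]
  have h2 := hb _ h1
  ext v w
  rw [← h2]
  have h3 : ∀ v, g.1 (g.inv.1 v) = v := DFunLike.congr_fun g.comp_inv
  conv_rhs => rw [h2]
  simp [h3]

/-! ### The nondegenerate case: invariant inner products -/

section Cocycle

variable {Ω : Type*} [MeasurableSpace Ω] {P : Measure Ω} [IsProbabilityMeasure P] {θ : Semiflow P}
  {Z : Type*} [MetricSpace Z] [SecondCountableTopology Z] [MeasurableSpace Z] [BorelSpace Z]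
  {T : ContinuousRDS θ Z} {μ : Measure Z} [IsProbabilityMeasure μ] {d : ℕ}

/-- If the fiber measures are nondegenerate, they are all equivalent under `SL_d`. -/
theorem exists_push_eq (hSF : T.StrongFeller) (hμ : T.ErgodicStationary μ)
    (A : LinearCocycle T d) (hA : A.IsSpecialLinear) {ν : Z → ProbabilityMeasure (Proj d)}
    (hν : ContinuousOn ν μ.support) (hinv : A.InvariantFamily hA μ ν)
    (hnd : ∀ z ∈ μ.support, ¬ Degenerate (ν z)) {z₀ : Z} (hz₀ : z₀ ∈ μ.support) :
    ∀ z ∈ μ.support, ∃ g : SL d, push g (ν z₀) = ν z := by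
  have hX : IsClosed μ.support := Measure.isClosed_support
  set B : Set Z := {z | z ∈ μ.support ∧ ∃ g : SL d, push g (ν z₀) = ν z} with hB
  have : B = μ.support := by
    refine eq_support_of_invariant hSF hμ A hA hν hinv ?_ (fun z hz => hz.1)
      ⟨z₀, hz₀, SL.one d, push_one _⟩ ?_
    · refine IsSeqClosed.isClosed fun y z hy hyz => ?_
      have hz : z ∈ μ.support := hX.mem_of_tendsto hyz (Eventually.of_forall fun n => (hy n).1)
      choose g hg using fun n => (hy n).2
      have hlim : Tendsto (fun n => ν (y n)) atTop (𝓝 (ν z)) :=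
        (hν z hz).tendsto.comp (tendsto_nhdsWithin_iff.2
          ⟨hyz, Eventually.of_forall fun n => (hy n).1⟩)
      have hlim' : Tendsto (fun n => push (g n) (ν z₀)) atTop (𝓝 (ν z)) := by
        simpa only [hg] using hlim
      -- Nondegeneracy of the limit `ν z` is what closes the orbit.
      obtain ⟨q, φ, hφ, hq⟩ := exists_subseq_tendsto_of_push hlim' (hnd z hz)
      refine ⟨hz, q, ?_⟩
      exact tendsto_nhds_unique ((continuous_push.tendsto (q, ν z₀)).comp
        (hq.prodMk_nhds tendsto_const_nhds)) (hlim'.comp hφ.tendsto_atTop)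
    · intro c hc z hz
      obtain ⟨h1, h2, h3⟩ := hc z hz
      refine and_congr (iff_of_true h1 hz) ⟨?_, ?_⟩
      · rintro ⟨g, hg⟩
        refine ⟨⟨_, det_comp_SL (SL.inv ⟨c.2 z, h2⟩) g⟩, ?_⟩
        rw [push_comp, hg, push_inv_eq h3]
      · rintro ⟨g, hg⟩
        refine ⟨⟨_, det_comp_SL ⟨c.2 z, h2⟩ g⟩, ?_⟩
        rw [push_comp, hg, h3]
  intro z hz
  rw [← this] at hz
  exact hz.2

theorem hasInvariantInnerProducts_of_nondegenerate (hSF : T.StrongFeller)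
    (hμ : T.ErgodicStationary μ) (A : LinearCocycle T d) (hA : A.IsSpecialLinear)
    {ν : Z → ProbabilityMeasure (Proj d)} (hν : ContinuousOn ν μ.support)
    (hinv : A.InvariantFamily hA μ ν) (hnd : ∀ z ∈ μ.support, ¬ Degenerate (ν z))
    {z₀ : Z} (hz₀ : z₀ ∈ μ.support) :
    HasInvariantInnerProducts A.totalSupport μ.support := by
  obtain ⟨b, hb, hbK⟩ := exists_invariant_innerProduct (hnd z₀ hz₀)
  have : ∀ z, ∃ g : SL d, z ∈ μ.support → push g (ν z₀) = ν z := by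
    intro z
    by_cases hz : z ∈ μ.support
    · obtain ⟨g, hg⟩ := exists_push_eq hSF hμ A hA hν hinv hnd hz₀ z hz
      exact ⟨g, fun _ => hg⟩
    · exact ⟨SL.one d, fun h => absurd h hz⟩
  choose g hg using this
  refine ⟨fun z => pull (g z).inv.1 b, ?_, ?_, ?_⟩
  · rw [continuousOn_iff_continuous_domRestrict, continuous_iff_continuousAt]
    intro z
    -- The choice `g` need not be continuous. Every subsequence of `g (y n)` has a further limit `q`
    -- with the same image as `g z`, and the transported forms for `q` and `g z` agree.
    refine tendsto_of_subseq_tendsto fun y hy => ?_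
    have hlim : Tendsto (fun n => push (g (y n)) (ν z₀)) atTop (𝓝 (ν z)) := by
      have h1 := ((continuousOn_iff_continuous_domRestrict.1 hν).tendsto z).comp hy
      refine h1.congr fun n => ?_
      exact (hg _ (y n).2).symm
    obtain ⟨q, φ, hφ, hq⟩ := exists_subseq_tendsto_of_push hlim (hnd z z.2)
    have hqz : push q (ν z₀) = push (g z) (ν z₀) := by
      rw [hg z z.2]
      exact tendsto_nhds_unique ((continuous_push.tendsto (q, ν z₀)).comp
        (hq.prodMk_nhds tendsto_const_nhds)) (hlim.comp hφ.tendsto_atTop)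
    refine ⟨φ, ?_⟩
    have h2 : Continuous fun q : SL d => pull q.inv.1 b :=
      (continuous_pull b).comp (continuous_subtype_val.comp SL.continuous_inv)
    have h3 := (h2.tendsto q).comp hq
    rw [pull_inv_eq_of_push_eq hbK hqz] at h3
    exact h3
  · intro z hz
    refine ⟨fun v w => hb.1 _ _, fun v hv => hb.2 ((g z).inv.1 v) fun h0 => hv ?_⟩
    exact injective_of_det_eq_one (g z).inv.2 (h0.trans (map_zero _).symm)
  · intro c hc z hz v w
    obtain ⟨h1, h2, h3⟩ := totalSupport_subset_preservers hμ.1 A hA hν hinv hc z hz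
    -- Both `h` and `g (c.1 z)` carry `ν z₀` to the measure at `c.1 z`, so they transport `b` to the
    -- same form.
    let h : SL d := ⟨(c.2 z).comp (g z).1, det_comp_SL ⟨c.2 z, h2⟩ (g z)⟩
    have h4 : push h (ν z₀) = push (g (c.1 z)) (ν z₀) := by
      rw [hg _ h1, ← h3, ← hg z hz]
      exact push_comp ⟨c.2 z, h2⟩ (g z) _ _
    have h5 : ∀ v, h.inv.1 (c.2 z v) = (g z).inv.1 v := by
      intro v
      have h6 : (g z).1 ((g z).inv.1 v) = v := DFunLike.congr_fun (g z).comp_inv v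
      have h7 : h.inv.1 (h.1 ((g z).inv.1 v)) = (g z).inv.1 v :=
        DFunLike.congr_fun h.inv_comp _
      rw [← h7]
      congr 1
      exact congrArg (c.2 z) h6.symm
    have h8 := pull_inv_eq_of_push_eq hbK h4
    simp only [← h8, pull_apply, h5]

end Cocycle

end FiberClass

theorem mainTheorem6
    {Ω : Type*} [MeasurableSpace Ω] {P : Measure Ω} [IsProbabilityMeasure P]
    {θ : FiberClass.Semiflow P}
    {Z : Type*} [MetricSpace Z] [CompleteSpace Z] [SecondCountableTopology Z]
    [MeasurableSpace Z] [BorelSpace Z]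
    (T : FiberClass.ContinuousRDS θ Z) (hT : T.IndepIncrements) (hSF : T.StrongFeller)
    (μ : Measure Z) [IsProbabilityMeasure μ] (hμ : T.ErgodicStationary μ)
    {d : ℕ} (hd_pos : 1 ≤ d) (hd : d ≤ 3)
    (A : FiberClass.LinearCocycle T d) (hA : A.IsSpecialLinear)
    (hA_int : A.LogIntegrable μ) (hA_indep : A.IndepIncrements)
    (ν : Z → ProbabilityMeasure (FiberClass.Proj d))
    (hν_cont : ContinuousOn ν μ.support) (hν_inv : A.InvariantFamily hA μ ν) :
    (∀ c ∈ A.totalSupport, ∀ z ∈ μ.support, c.1 z ∈ μ.support) ∧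
    (FiberClass.HasInvariantInnerProducts A.totalSupport μ.support ∨
      FiberClass.HasInvariantSubspaces A.totalSupport μ.support ν) := by
  have hae : ∀ᵐ z ∂μ, z ∈ μ.support := Measure.support_mem_ae
  obtain ⟨z₀, hz₀⟩ := hae.exists
  refine ⟨fun c hc z hz =>
    (FiberClass.totalSupport_subset_preservers hμ.1 A hA hν_cont hν_inv hc z hz).1, ?_⟩
  by_cases h : ∃ z ∈ μ.support, FiberClass.Degenerate (ν z)
  · obtain ⟨z, hz, hdeg⟩ := h
    exact Or.inr (FiberClass.hasInvariantSubspaces_of_degenerate hSF hμ A hA hν_cont hν_inv hz hdeg)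
  · push Not at h
    exact Or.inl (FiberClass.hasInvariantInnerProducts_of_nondegenerate hSF hμ A hA hν_cont hν_inv
      h hz₀)
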